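/- **Conventions.** Let $X$ be an infinite compact Hausdorff space and $\sigma:X\to X$ a minimal homeomorphism (every orbit $\{\sigma^k(x):k\in\mathbb Z\}$ is dense). In the crossed product $C^*(\mathbb Z,X,\sigma)$ let $u$ be the canonical unitary, so that $ufu^*=f\circ\sigma^{-1}$ for $f\in C(X)$. For $W\subseteq X$ let $A_W$ be the $C^*$-subalgebra of $C^*(\mathbb Z,X,\sigma)$ generated by $C(X)$ and all $ug$ with $g\in C(X)$, $g|_W=0$. A *DSH algebra* with compact Hausdorff spaces $X_1,\dots,X_l$ ($l\ge 1$), closed subspaces $Y_i\subseteq X_i$ and dimensions $n_1,\dots,n_l\ge 1$ is an algebra $A_l\subseteq\bigoplus_{i=1}^l C(X_i,M_{n_i})$ obtained as follows: $A_1=C(X_1,M_{n_1})$, and for $1\le i<l$ $$A_{i+1}=\{(a,f)\in A_i\oplus C(X_{i+1},M_{n_{i+1}}):\ \phi_i(a)=f|_{Y_{i+1}}\},$$ where $\phi_i:A_i\to C(Y_{i+1},M_{n_{i+1}})$ is a homomorphism such that for each $y\in Y_{i+1}$ there are points $x_k\in X_{i_k}$, $i_k\le i$, $1\le k\le s$,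 with $\phi_i(f)(y)=\mathrm{diag}(f_{i_1}(x_1),\dots,f_{i_s}(x_s))$ for all $f\in A_i$. A homomorphism $\phi:A\to B$ between DSH algebras $A\subseteq\bigoplus_i C(X_i,M_{n_i})$ and $B\subseteq\bigoplus_j C(X'_j,M_{n'_j})$ is *diagonal* if for every $j$ and $x\in X'_j$ there are points $x_k\in X_{i_k}$, $1\le k\le s$, with $\phi(f)_j(x)=\mathrm{diag}(f_{i_1}(x_1),\dots,f_{i_s}(x_s))$ for all $f\in A$. **Lemma 1.4.** Let $Z\subseteq Y\subseteq X$, where $Y$ and $Z$ are closures of open subsets of $X$ and $Z\neq\emptyset$. 1. Let $W$ be $Y$ or $Z$. Every $y\in W$ has a first return time $R_W(y)=\min\{n>0:\sigma^n(y)\in W\}$, and $R_W$ takes only finitely many values $n_1<\dots<n_l$ on $W$. Put $X_i=\overline{R_W^{-1}(n_i)}$ and $Y_i=X_i\setminus R_W^{-1}(n_i)$. Then there is a $*$-isomorphism $\iota_W$ from $A_W$ onto a DSH algebra with spaces $X_i$, closed subspaces $Y_i$ and dimensions $n_i$ such that, for $y\in X_i$, $f\in C(X)$, and $g\in C(X)$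 with $g|_W=0$, $$\iota_W(f)_i(y)=\mathrm{diag}\big(f(\sigma(y)),\dots,f(\sigma^{n_i}(y))\big),$$ and $\iota_W(ug)_i(y)$ is the matrix with entries $g(\sigma(y)),\dots,g(\sigma^{n_i-1}(y))$ on the first subdiagonal and $0$ elsewhere. Moreover, for $y\in Y_i$ there are $t_1,\dots,t_s<i$ with $n_{t_1}+\dots+n_{t_s}=n_i$ such that, with $S_j=n_{t_1}+\dots+n_{t_j}$, the times $1\le r\le n_i$ with $\sigma^r(y)\in W$ are exactly $S_1,\dots,S_s$, $\sigma^{S_{j-1}}(y)\in X_{t_j}$ for $1\le j\le s$, and every $f$ in the DSH algebra satisfies $$f_i(y)=\mathrm{diag}\big(f_{t_1}(y),f_{t_2}(\sigma^{S_1}(y)),\dots,f_{t_s}(\sigma^{S_{s-1}}(y))\big).$$ 2. $A_Y\subseteq A_Z$, and the inclusion, read through $\iota_Y$ and $\iota_Z$ as a homomorphism $\phi=\iota_Z\circ\iota_Y^{-1}$ from $\iota_Y(A_Y)$ to $\iota_Z(A_Z)$, is a diagonal map between DSH algebras. Explicitly, let $n_1<\dots<n_l$ and $X_i$ be the return times and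 spaces for $Y$, let $q_1<\dots<q_w$ be the return times to $Z$, and let $z\in\overline{R_Z^{-1}(q_i)}$. Then there are $t_1,\dots,t_s$ with $n_{t_1}+\dots+n_{t_s}=q_i$ such that, with $S_j=n_{t_1}+\dots+n_{t_j}$, the times $1\le r\le q_i$ with $\sigma^r(z)\in Y$ are exactly $S_1,\dots,S_s$, $\sigma^{S_{j-1}}(z)\in X_{t_j}$ for $1\le j\le s$, and for all $f\in\iota_Y(A_Y)$ $$\phi(f)_i(z)=\mathrm{diag}\big(f_{t_1}(z),f_{t_2}(\sigma^{S_1}(z)),\dots,f_{t_s}(\sigma^{S_{s-1}}(z))\big).$$ -/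

import Mathlib

universe u v w

/-! ## Diagonal subhomogeneous algebras

`C(X, Matrix (Fin n) (Fin n) ℂ)` carries Mathlib's pointwise `*`-algebra structure (the topology of
matrices being entrywise, i.e. the norm topology).  `*`-isomorphisms and injective `*`-homomorphisms
of C*-algebras are isometric, so only the `*`-algebra structure is recorded. -/

/-- The `n × n` complex matrices. -/
abbrev Mat (n : ℕ) : Type := Matrix (Fin n) (Fin n) ℂ

/-- The direct sum `⨁ i, C(X i, M_{n i})` over a finite index set `ι`. -/
abbrev MatFun {ι : Type w} (X : ι → Type u) [∀ i, TopologicalSpace (X i)] (n : ι → ℕ) :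
    Type (max w u) :=
  ∀ i, C(X i, Mat (n i))

/-- `IsBlockDiag d B M` says that `M = diag(B 0, …, B (s-1))`, where `B k` has size `d k`: the sizes
add up to the size of `M`, and `M` is the block diagonal matrix with these blocks in this order. -/
def IsBlockDiag {q s : ℕ} (d : Fin s → ℕ) (B : ∀ k, Mat (d k)) (M : Mat q) : Prop :=
  ∃ h : ∑ k, d k = q,
    M = Matrix.reindex (finSigmaFinEquiv.trans (finCongr h)) (finSigmaFinEquiv.trans (finCongr h))
      (Matrix.blockDiagonal' B)

/-- Composition sequences, of length `l + 1` (indices start at `0`), of diagonal subhomogeneous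
algebras with spaces `X i`, restriction subspaces `Y i` and dimensions `n i`.
`stage i ⊆ ⨁_{j ≤ i} C(X j, M_{n j})` is the algebra obtained after step `i`. -/
structure DSHSequence {l : ℕ} (X : Fin (l + 1) → Type u) [∀ i, TopologicalSpace (X i)]
    (n : Fin (l + 1) → ℕ) (Y : ∀ i, Set (X i)) where
  stage : ∀ i : Fin (l + 1),
    StarSubalgebra ℂ (MatFun (fun j : Set.Iic i => X j.1) (fun j => n j.1))
  glue : ∀ i : Fin l, stage i.castSucc →⋆ₐ[ℂ] C(Y i.succ, Mat (n i.succ))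
  stage_zero : stage 0 = ⊤
  /-- Each gluing homomorphism is diagonal: at `y` it is given by a list of points of the
  earlier spaces. -/
  glue_diag : ∀ (i : Fin l) (y : Y i.succ),
    ∃ (s : ℕ) (t : Fin s → Set.Iic i.castSucc) (p : ∀ k, X (t k).1),
      ∀ f : stage i.castSucc,
        IsBlockDiag (fun k => n (t k).1) (fun k => f.1 (t k) (p k)) (glue i f y)
  /-- The next stage is the pullback of the present one with `C(X (i+1), M_{n (i+1)})`. -/
  stage_succ : ∀ (i : Fin l)
    (f : MatFun (fun j : Set.Iic i.succ => X j.1) (fun j => n j.1)),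
      f ∈ stage i.succ ↔
        ∃ h : (fun j : Set.Iic i.castSucc =>
            f ⟨j.1, Set.mem_Iic.2 (le_trans j.2 i.castSucc_lt_succ.le)⟩) ∈ stage i.castSucc,
          glue i ⟨_, h⟩ = (f ⟨i.succ, Set.mem_Iic.2 le_rfl⟩).restrict (Y i.succ)

/-- The subalgebra `A` of `⨁ i, C(X i, M_{n i})` is diagonal subhomogeneous (DSH), with a
composition sequence whose spaces, restriction subspaces and dimensions are `X`, `Y`, `n`. -/
def IsDSH {l : ℕ} (X : Fin (l + 1) → Type u) [∀ i, TopologicalSpace (X i)]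
    (Y : ∀ i, Set (X i)) (n : Fin (l + 1) → ℕ) (A : StarSubalgebra ℂ (MatFun X n)) : Prop :=
  (∀ i, CompactSpace (X i)) ∧ (∀ i, T2Space (X i)) ∧ (∀ i, IsClosed (Y i)) ∧ (∀ i, 0 < n i) ∧
    ∃ D : DSHSequence X n Y,
      ∀ f : MatFun X n, f ∈ A ↔ (fun j : Set.Iic (Fin.last l) => f j.1) ∈ D.stage (Fin.last l)

/-- A homomorphism between algebras of matrix-valued functions is diagonal: each evaluation of
`φ f` is the block diagonal sum of the values of `f` at a list of points that does not depend
on `f`. -/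
def IsDiagonalMap {l l' : ℕ} {X : Fin (l + 1) → Type u} [∀ i, TopologicalSpace (X i)]
    {n : Fin (l + 1) → ℕ} {X' : Fin (l' + 1) → Type v} [∀ i, TopologicalSpace (X' i)]
    {n' : Fin (l' + 1) → ℕ} {A : StarSubalgebra ℂ (MatFun X n)}
    {B : StarSubalgebra ℂ (MatFun X' n')} (φ : A →⋆ₐ[ℂ] B) : Prop :=
  ∀ (i : Fin (l' + 1)) (x : X' i),
    ∃ (s : ℕ) (t : Fin s → Fin (l + 1)) (p : ∀ k, X (t k)),
      ∀ f : A, IsBlockDiag (fun k => n (t k)) (fun k => f.1 (t k) (p k)) ((φ f).1 i x)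

/-! ## The crossed product and its orbit-breaking subalgebras -/

noncomputable section

variable {X : Type u}

/-- Every orbit is dense. -/
def IsMinimalHomeo [TopologicalSpace X] (σ : X ≃ₜ X) : Prop :=
  ∀ x : X, Dense (Set.range fun k : ℤ => (σ ^ k) x)

/-- The Hilbert space `ℓ²(X × ℤ)`. -/
abbrev RegRepSpace (X : Type u) : Type u := lp (fun _ : X × ℤ => ℂ) 2

/-- The shift `(U ξ)(x, k) = ξ(x, k - 1)` on `ℓ²(X × ℤ)`. -/
def regularShift (X : Type u) : RegRepSpace X →L[ℂ] RegRepSpace X :=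
  have hsum (ξ : RegRepSpace X) :=
    ((Equiv.refl X).prodCongr (Equiv.subRight (1 : ℤ))).summable_iff.mpr
      ((lp.memℓp ξ).summable (by simp))
  LinearMap.mkContinuous
    { toFun ξ := ⟨fun a => ξ (a.1, a.2 - 1), memℓp_gen (hsum ξ)⟩
      map_add' _ _ := rfl
      map_smul' _ _ := rfl } 1
    (fun ξ => by
      rw [one_mul]
      refine lp.norm_le_of_tsum_le (by simp) (norm_nonneg _) ?_
      rw [lp.norm_rpow_eq_tsum (by simp) ξ]
      exact (((Equiv.refl X).prodCongr (Equiv.subRight (1 : ℤ))).tsum_eq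
        (fun a => ‖ξ a‖ ^ (2 : ENNReal).toReal)).le)

@[simp] theorem regularShift_apply (ξ : RegRepSpace X) (a : X × ℤ) :
    regularShift X ξ a = ξ (a.1, a.2 - 1) := rfl

/-- The inverse shift `ξ ↦ ((x, k) ↦ ξ(x, k + 1))` is the adjoint of `U`. -/
theorem star_regularShift_apply (ξ : RegRepSpace X) (a : X × ℤ) :
    (star (regularShift X) ξ) a = ξ (a.1, a.2 + 1) := by
  classical
  have h := lp.inner_single_left (𝕜 := ℂ) a (1 : ℂ) (star (regularShift X) ξ)
  have hs : regularShift X (lp.single 2 a (1 : ℂ)) = lp.single 2 (a.1, a.2 + 1) (1 : ℂ) := by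
    ext b
    simp only [regularShift_apply, lp.single_apply, Pi.single_apply, Prod.ext_iff,
      sub_eq_iff_eq_add]
  rw [ContinuousLinearMap.star_eq_adjoint, ContinuousLinearMap.adjoint_inner_right, hs,
    lp.inner_single_left] at h
  simpa [ContinuousLinearMap.star_eq_adjoint] using h.symm

theorem regularShift_mem_unitary : regularShift X ∈ unitary (RegRepSpace X →L[ℂ] RegRepSpace X) := by
  rw [Unitary.mem_iff]
  constructor <;> ext ξ a <;> simp [star_regularShift_apply]

variable [TopologicalSpace X] [CompactSpace X]

/-- The multiplication operators `(f ξ)(x, k) = f(σᵏ x) ξ(x, k)` on `ℓ²(X × ℤ)`. -/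
def regularMul (σ : X ≃ₜ X) (f : C(X, ℂ)) : RegRepSpace X →L[ℂ] RegRepSpace X :=
  lp.mapCLM 2 (fun a : X × ℤ => f ((σ ^ a.2) a.1) • ContinuousLinearMap.id ℂ ℂ)
    (K := ‖f‖) (norm_nonneg f) (fun a => by
      simpa [norm_smul] using f.norm_coe_le_norm ((σ ^ a.2) a.1))

@[simp] theorem regularMul_apply (σ : X ≃ₜ X) (f : C(X, ℂ)) (ξ : RegRepSpace X) (a : X × ℤ) :
    regularMul σ f ξ a = f ((σ ^ a.2) a.1) * ξ a := by
  simp [regularMul]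

/-- `regularMul` as a representation of `C(X)`. -/
def regularRep (σ : X ≃ₜ X) : C(X, ℂ) →⋆ₐ[ℂ] (RegRepSpace X →L[ℂ] RegRepSpace X) where
  toFun := regularMul σ
  map_one' := by ext ξ a; simp
  map_mul' f g := by ext ξ a; simp [mul_assoc]
  map_zero' := by ext ξ a; simp
  map_add' f g := by ext ξ a; simp [add_mul]
  commutes' c := by ext ξ a; simp [Algebra.algebraMap_eq_smul_one]
  map_star' f := by
    rw [ContinuousLinearMap.star_eq_adjoint, ContinuousLinearMap.eq_adjoint_iff]
    intro ξ η
    simp only [lp.inner_eq_tsum]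
    refine tsum_congr fun a => ?_
    simp [mul_assoc, mul_left_comm]

/-- The crossed product `C*(ℤ, X, σ)`: the C*-algebra generated by `C(X)` and the unitary `U` in the
regular representation on `ℓ²(X × ℤ)`.  (As `ℤ` is amenable, the full and the reduced crossed
products coincide.) -/
def crossedProduct (σ : X ≃ₜ X) : StarSubalgebra ℂ (RegRepSpace X →L[ℂ] RegRepSpace X) :=
  (StarAlgebra.adjoin ℂ (Set.range (regularRep σ) ∪ {regularShift X})).topologicalClosure

/-- The inclusion of `C(X)` in the crossed product. -/
def crossedFun (σ : X ≃ₜ X) : C(X, ℂ) →⋆ₐ[ℂ] crossedProduct σ :=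
  (regularRep σ).codRestrict _ fun f =>
    StarSubalgebra.le_topologicalClosure _
      (StarAlgebra.subset_adjoin ℂ _ (Or.inl ⟨f, rfl⟩))

/-- The canonical unitary of the crossed product. -/
def crossedUnit (σ : X ≃ₜ X) : crossedProduct σ :=
  ⟨regularShift X, StarSubalgebra.le_topologicalClosure _
    (StarAlgebra.subset_adjoin ℂ _ (Or.inr rfl))⟩

theorem crossedUnit_mem_unitary (σ : X ≃ₜ X) : crossedUnit σ ∈ unitary (crossedProduct σ) := by
  have h := Unitary.mem_iff.mp (regularShift_mem_unitary (X := X))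
  exact Unitary.mem_iff.mpr ⟨Subtype.ext h.1, Subtype.ext h.2⟩

/-- The covariance relation `u f u* = f ∘ σ⁻¹`. -/
theorem crossedUnit_covariance (σ : X ≃ₜ X) (f : C(X, ℂ)) :
    crossedUnit σ * crossedFun σ f * star (crossedUnit σ) =
      crossedFun σ (f.comp (σ.symm : C(X, X))) := by
  apply Subtype.ext
  change regularShift X * regularMul σ f * star (regularShift X) = regularMul σ _
  ext ξ a
  simp [star_regularShift_apply, sub_eq_add_neg, add_comm a.2 (-1), zpow_add]

/-- The orbit-breaking algebra `A_W`: the C*-subalgebra of the crossed product generated by `C(X)`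
and the elements `u g` with `g ∈ C(X)` vanishing on `W`. -/
def orbitBreaking (σ : X ≃ₜ X) (W : Set X) : StarSubalgebra ℂ (crossedProduct σ) :=
  (StarAlgebra.adjoin ℂ (Set.range (crossedFun σ) ∪
    {a | ∃ g : C(X, ℂ), (∀ y ∈ W, g y = 0) ∧ a = crossedUnit σ * crossedFun σ g})).topologicalClosure

theorem crossedFun_mem (σ : X ≃ₜ X) (W : Set X) (f : C(X, ℂ)) :
    crossedFun σ f ∈ orbitBreaking σ W :=
  StarSubalgebra.le_topologicalClosure _ (StarAlgebra.subset_adjoin ℂ _ (Or.inl ⟨f, rfl⟩))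

theorem crossedUnit_mul_mem (σ : X ≃ₜ X) (W : Set X) (g : C(X, ℂ)) (hg : ∀ y ∈ W, g y = 0) :
    crossedUnit σ * crossedFun σ g ∈ orbitBreaking σ W :=
  StarSubalgebra.le_topologicalClosure _ (StarAlgebra.subset_adjoin ℂ _ (Or.inr ⟨g, hg, rfl⟩))

theorem orbitBreaking_anti (σ : X ≃ₜ X) {W W' : Set X} (h : W ⊆ W') :
    orbitBreaking σ W' ≤ orbitBreaking σ W := by
  refine closure_mono ?_
  refine StarAlgebra.adjoin_le (Set.union_subset ?_ ?_)
  · exact fun a ha => StarAlgebra.subset_adjoin ℂ _ (Or.inl ha)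
  · rintro a ⟨g, hg, rfl⟩
    exact StarAlgebra.subset_adjoin ℂ _ (Or.inr ⟨g, fun y hy => hg y (h hy), rfl⟩)

end

/-! ## First return times -/

noncomputable section

variable {X : Type u} [TopologicalSpace X]

/-- The first return time `min {n > 0 | σⁿ y ∈ W}` (with the value `0` if there is no return). -/
def returnTime (σ : X ≃ₜ X) (W : Set X) (y : X) : ℕ :=
  sInf {n : ℕ | 0 < n ∧ (σ ^ n) y ∈ W}

/-- The set of points of `W` with first return time `n`. -/
def returnLevel (σ : X ≃ₜ X) (W : Set X) (n : ℕ) : Set X :=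
  {y | y ∈ W ∧ returnTime σ W y = n}

/-- The closure of the set of points of `W` with first return time `n`. -/
abbrev ReturnSpace (σ : X ≃ₜ X) (W : Set X) (n : ℕ) : Type u :=
  closure (returnLevel σ W n)

/-- The points of the closure which do not themselves have first return time `n`. -/
def returnBoundary (σ : X ≃ₜ X) (W : Set X) (n : ℕ) : Set (ReturnSpace σ W n) :=
  {y | (y : X) ∉ returnLevel σ W n}

/-- The visits to `W` of the orbit segment `z, σ z, …, σ^q z` cut it into `s` pieces of lengths
`n (t 0), …, n (t (s-1))`; the `k`-th piece starts at the point `p k` of the closure of the set of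
points with first return time `n (t k)`. -/
def IsReturnSplitting (σ : X ≃ₜ X) (W : Set X) {l : ℕ} (n : Fin (l + 1) → ℕ) (q : ℕ) (z : X)
    {s : ℕ} (t : Fin s → Fin (l + 1)) (p : ∀ k, ReturnSpace σ W (n (t k))) : Prop :=
  ∑ k, n (t k) = q ∧
  (∀ k, (p k : X) = (σ ^ (∑ j ∈ Finset.Iio k, n (t j))) z) ∧
  ∀ r : ℕ, 1 ≤ r → r ≤ q → ((σ ^ r) z ∈ W ↔ ∃ k, r = ∑ j ∈ Finset.Iic k, n (t j))

variable [CompactSpace X]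

/-- The description of `A_W` by first return times to `W`: `n` lists the return times in increasing
order, `D` is a DSH algebra with spaces `ReturnSpace σ W (n i)`, restriction subspaces
`returnBoundary σ W (n i)` and dimensions `n i`, and `Ψ : A_W ≃ D` is the isomorphism with
`Ψ(f)ᵢ = diag(f ∘ σ, …, f ∘ σ^{nᵢ})`, and `Ψ(u g)ᵢ` the matrix with subdiagonal
`g ∘ σ, …, g ∘ σ^{nᵢ - 1}` and zeros elsewhere. -/
structure IsReturnPresentation (σ : X ≃ₜ X) (W : Set X) {l : ℕ} (n : Fin (l + 1) → ℕ)
    (D : StarSubalgebra ℂ (MatFun (fun i => ReturnSpace σ W (n i)) n))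
    (Ψ : orbitBreaking σ W ≃⋆ₐ[ℂ] D) : Prop where
  returns : ∀ y ∈ W, ∃ k : ℕ, 0 < k ∧ (σ ^ k) y ∈ W
  strictMono : StrictMono n
  range_eq : Set.range n = returnTime σ W '' W
  isDSH : IsDSH (fun i => ReturnSpace σ W (n i)) (fun i => returnBoundary σ W (n i)) n D
  apply_fun : ∀ (f : C(X, ℂ)) (i : Fin (l + 1)) (y : ReturnSpace σ W (n i)),
    (Ψ ⟨crossedFun σ f, crossedFun_mem σ W f⟩).1 i y =
      Matrix.diagonal fun a : Fin (n i) => f ((σ ^ (a.1 + 1)) y.1)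
  apply_unit_mul : ∀ (g : C(X, ℂ)) (hg : ∀ y ∈ W, g y = 0) (i : Fin (l + 1))
      (y : ReturnSpace σ W (n i)),
    (Ψ ⟨crossedUnit σ * crossedFun σ g, crossedUnit_mul_mem σ W g hg⟩).1 i y =
      Matrix.of fun a b : Fin (n i) => if a.1 = b.1 + 1 then g ((σ ^ (b.1 + 1)) y.1) else 0
  /-- The diagonal decomposition over the restriction subspaces. -/
  boundary : ∀ (i : Fin (l + 1)), ∀ y ∈ returnBoundary σ W (n i),
    ∃ (s : ℕ) (t : Fin s → Fin (l + 1)) (p : ∀ k, ReturnSpace σ W (n (t k))),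
      IsReturnSplitting σ W n (n i) y.1 t p ∧ (∀ k, t k < i) ∧
        ∀ f : D, IsBlockDiag (fun k => n (t k)) (fun k => f.1 (t k) (p k)) (f.1 i y)

/-- The inclusion `A_Y ⊆ A_Z` for `Z ⊆ Y`, read through isomorphisms of `A_Y` and `A_Z` with
subalgebras of matrix-valued functions. -/
def inclusionHom (σ : X ≃ₜ X) {Y Z : Set X} (hZY : Z ⊆ Y)
    {B : Type v} {C : Type w} [Semiring B] [Algebra ℂ B] [StarRing B]
    [Semiring C] [Algebra ℂ C] [StarRing C]
    (ΨY : orbitBreaking σ Y ≃⋆ₐ[ℂ] B) (ΨZ : orbitBreaking σ Z ≃⋆ₐ[ℂ] C) : B →⋆ₐ[ℂ] C :=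
  ((ΨZ : orbitBreaking σ Z →⋆ₐ[ℂ] C).comp
    (StarSubalgebra.inclusion (orbitBreaking_anti σ hZY))).comp (ΨY.symm : B →⋆ₐ[ℂ] orbitBreaking σ Y)

end

/-! ## Blocks of orbits between consecutive visits -/

section Dynamics

variable {X : Type u} [TopologicalSpace X] {σ : X ≃ₜ X} {W : Set X}

/-! On the fibre of `ℓ²(X × ℤ)` over a point `x`, an operator is a matrix indexed by times along the
orbit of `x`. The generators `f` and `u g`, with `g = 0` on `W`, have entries that depend
continuously on `x`, are equivariant under moving along the orbit, and vanish between two times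
separated by a visit to `W`. These properties survive products with generators, adjoints and norm
limits, so every element of `A_W` has them. It is therefore block diagonal on each orbit, and the
blocks are the half-open time intervals `(v, v']` between consecutive visits `v < v'`. Compactness
and minimality bound the length of the blocks, and `orbitHom` sends an element to its blocks. It is
multiplicative because an orbit segment from `W` to `W` is a union of blocks, and injective because
every time lies in a block.

For the image, all blocks of a family `f` are encoded in one kernel: `blockKernel f m x` is the
entry `m` steps from the diagonal, in the column at the position of `x`. A family is compatible
(`IsKernelAt`) if its values on the closures of the return levels also come from this kernel,
equivalently if they decompose along the visits to `W`. At points with exactly the given return time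
this is automatic; on the boundary all pieces are strictly shorter, which is the DSH gluing
condition (`isKernelAt_iff_glueHom`).

Compatible families exhaust the image: finitely many closed sets cover `X`, and on each of them the
kernel is an entry of `f` or zero, so the kernel is continuous. The family then comes from a finite
sum of terms `u^m g` and their adjoints, which lie in `A_W` by a square-root factorisation
(`crossedUnit_pow_mul_mem`).

For `Z ⊆ Y` the inclusion leaves the operator unchanged. A segment from `Z` to `Z` starts and ends
in `Y`, and cutting it at its visits to `Y` gives the diagonal form. -/

theorem zpow_add_apply (σ : X ≃ₜ X) (a b : ℤ) (x : X) :
    (σ ^ (a + b)) x = (σ ^ a) ((σ ^ b) x) := by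
  rw [zpow_add]; rfl

theorem zpow_eq_of_eq_add (σ : X ≃ₜ X) {a b c : ℤ} (h : a = b + c) (x : X) :
    (σ ^ b) ((σ ^ c) x) = (σ ^ a) x := by
  rw [h, zpow_add_apply]

/-- Every orbit visits `W` at a positive time which is at most `N`. -/
def ReturnsWithin (σ : X ≃ₜ X) (W : Set X) (N : ℕ) : Prop :=
  ∀ x, ∃ k : ℕ, 0 < k ∧ k ≤ N ∧ (σ ^ (k : ℤ)) x ∈ W

/-- By minimality the integer translates of `U` cover `X`; a finite subcover bounds the waiting time
uniformly. -/
theorem exists_returnsWithin [CompactSpace X] (hσ : IsMinimalHomeo σ) {U : Set X}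
    (hU : IsOpen U) (hne : U.Nonempty) (hUW : U ⊆ W) : ∃ N, ReturnsWithin σ W N := by
  obtain ⟨F, hF⟩ := isCompact_univ.elim_finite_subcover (fun k : ℤ => (σ ^ k) ⁻¹' U)
    (fun k => hU.preimage (σ ^ k).continuous) (by
      intro x _
      obtain ⟨_, hy, k, rfl⟩ := (hσ x).inter_open_nonempty U hU hne
      exact Set.mem_iUnion.2 ⟨k, hy⟩)
  obtain ⟨M, hM⟩ : ∃ M : ℕ, ∀ k ∈ F, k.natAbs ≤ M :=
    ⟨F.sup Int.natAbs, fun k hk => Finset.le_sup (f := Int.natAbs) hk⟩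
  -- The subcover uses exponents in `[-M, M]`. Applying it at `σ ^ (M + 1) x` turns them into times
  -- in `[1, 2 * M + 1]`.
  refine ⟨2 * M + 1, fun x => ?_⟩
  obtain ⟨k, hk, hx⟩ : ∃ k ∈ F, (σ ^ k) ((σ ^ (M + 1 : ℤ)) x) ∈ U := by
    simpa using hF (Set.mem_univ ((σ ^ (M + 1 : ℤ)) x))
  have := hM k hk
  refine ⟨(k + (M + 1)).toNat, by omega, by omega, ?_⟩
  rw [zpow_eq_of_eq_add σ rfl] at hx
  rw [Int.toNat_of_nonneg (by omega)]
  exact hUW hx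

variable {N : ℕ}

theorem ReturnsWithin.mono {W' : Set X} (h : ReturnsWithin σ W N) (hW : W ⊆ W') :
    ReturnsWithin σ W' N := fun x => by
  obtain ⟨k, h1, h2, h3⟩ := h x
  exact ⟨k, h1, h2, hW h3⟩

theorem ReturnsWithin.exists_backward (h : ReturnsWithin σ W N) (x : X) :
    ∃ k : ℕ, 0 < k ∧ (σ ^ (-k : ℤ)) x ∈ W := by
  -- Starting `N + 1` steps in the past, a return within `N` steps is still strictly before `x`.
  obtain ⟨k, h1, h2, h3⟩ := h ((σ ^ (-N - 1 : ℤ)) x)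
  refine ⟨N + 1 - k, by omega, ?_⟩
  rwa [zpow_eq_of_eq_add σ (a := -((N + 1 - k : ℕ) : ℤ)) (by omega)] at h3

theorem ReturnsWithin.nonempty_times (h : ReturnsWithin σ W N) (y : X) :
    {n : ℕ | 0 < n ∧ (σ ^ n) y ∈ W}.Nonempty := by
  obtain ⟨k, h1, _, h3⟩ := h y
  exact ⟨k, h1, by simpa using h3⟩

theorem ReturnsWithin.returnTime_pos (h : ReturnsWithin σ W N) (y : X) :
    0 < returnTime σ W y :=
  (Nat.sInf_mem (h.nonempty_times y)).1

theorem ReturnsWithin.returnTime_mem (h : ReturnsWithin σ W N) (y : X) :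
    (σ ^ (returnTime σ W y : ℤ)) y ∈ W := by
  rw [zpow_natCast]
  exact (Nat.sInf_mem (h.nonempty_times y)).2

theorem ReturnsWithin.returnTime_le (h : ReturnsWithin σ W N) (y : X) :
    returnTime σ W y ≤ N := by
  obtain ⟨k, h1, h2, h3⟩ := h y
  refine (Nat.sInf_le (show k ∈ {n : ℕ | 0 < n ∧ (σ ^ n) y ∈ W} from ⟨h1, ?_⟩)).trans h2
  simpa using h3

theorem returnTime_le_of_mem {y : X} {j : ℤ} (hj : 0 < j) (hm : (σ ^ j) y ∈ W) :
    (returnTime σ W y : ℤ) ≤ j := by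
  lift j to ℕ using hj.le
  have hj' : j ∈ {n : ℕ | 0 < n ∧ (σ ^ n) y ∈ W} :=
    ⟨by exact_mod_cast hj, by simpa using hm⟩
  exact_mod_cast Nat.sInf_le hj'

/-- The points of `W` that return for the first time after `r` steps. -/
theorem ReturnsWithin.mem_returnLevel (h : ReturnsWithin σ W N) {y : X} {r : ℕ} :
    y ∈ returnLevel σ W r ↔ y ∈ W ∧ 0 < r ∧ (σ ^ (r : ℤ)) y ∈ W ∧
      ∀ j : ℤ, 0 < j → j < r → (σ ^ j) y ∉ W := by
  constructor
  · rintro ⟨hy, rfl⟩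
    refine ⟨hy, h.returnTime_pos y, h.returnTime_mem y, fun j hj hlt hm => ?_⟩
    have := returnTime_le_of_mem hj hm
    omega
  · rintro ⟨hy, hr, hm, hn⟩
    refine ⟨hy, le_antisymm ?_ ?_⟩
    · exact_mod_cast returnTime_le_of_mem (by exact_mod_cast hr) hm
    · by_contra! hlt
      exact hn _ (by exact_mod_cast h.returnTime_pos y) (by exact_mod_cast hlt)
        (h.returnTime_mem y)

/-- Visits at both ends of the segment are closed conditions and pass to the closure of the level.
The absence of visits in between does not, and this is where boundary points come from. -/
theorem ReturnsWithin.mem_of_mem_closure (h : ReturnsWithin σ W N) (hW : IsClosed W) {y : X}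
    {r : ℕ} (hy : y ∈ closure (returnLevel σ W r)) :
    y ∈ W ∧ (σ ^ (r : ℤ)) y ∈ W := by
  have hc : IsClosed (W ∩ (σ ^ (r : ℤ)) ⁻¹' W) :=
    hW.inter (hW.preimage (σ ^ (r : ℤ)).continuous)
  have hsub : returnLevel σ W r ⊆ W ∩ (σ ^ (r : ℤ)) ⁻¹' W :=
    fun z hz => ⟨hz.1, (h.mem_returnLevel.1 hz).2.2.1⟩
  exact closure_minimal hsub hc hy

/-- Boundary points are exactly those with a visit at some time strictly between `0` and `r`, a
finite union of closed conditions. -/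
theorem ReturnsWithin.isClosed_returnBoundary (h : ReturnsWithin σ W N) (hW : IsClosed W)
    {r : ℕ} (hr : 0 < r) : IsClosed (returnBoundary σ W r) := by
  have : returnBoundary σ W r =
      ⋃ j ∈ Finset.Ioo (0 : ℤ) r, (fun y : ReturnSpace σ W r => (σ ^ j) y.1) ⁻¹' W := by
    ext y
    have hy := h.mem_of_mem_closure hW y.2
    simp only [returnBoundary, Set.mem_ofPred_eq, h.mem_returnLevel, hy.1, hr, hy.2, true_and,
      Set.mem_iUnion, Finset.mem_Ioo, Set.mem_preimage]
    push Not
    simp [and_assoc]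
  rw [this]
  exact isClosed_biUnion_finset fun j _ =>
    hW.preimage ((σ ^ j).continuous.comp continuous_subtype_val)

variable {ι : Type*} {n : ι → ℕ}

/-- `x` is `σ ^ (b + 1) w` for a point `w` of `W` with first return time `n i`, where `b < n i`. -/
def IsBlockPosition (σ : X ≃ₜ X) (W : Set X) (n : ι → ℕ) (x : X) (c : Σ i, Fin (n i)) : Prop :=
  (σ ^ (-(c.2 : ℤ) - 1)) x ∈ returnLevel σ W (n c.1)

/-- Of two different offsets, the smaller one would give a visit to `W` strictly inside the block of
the other. -/
theorem ReturnsWithin.blockPosition_unique (h : ReturnsWithin σ W N) (hn : Function.Injective n)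
    {x : X} {c c' : Σ i, Fin (n i)} (hc : IsBlockPosition σ W n x c)
    (hc' : IsBlockPosition σ W n x c') : c = c' := by
  have key : ∀ {c c' : Σ i, Fin (n i)}, IsBlockPosition σ W n x c →
      IsBlockPosition σ W n x c' → ¬ (c.2 : ℕ) < c'.2 := by
    intro c c' hc hc' hlt
    refine (h.mem_returnLevel.1 hc').2.2.2 (c'.2 - c.2 : ℤ) (by omega) (by omega) ?_
    rw [zpow_eq_of_eq_add σ (a := -(c.2 : ℤ) - 1) (by omega)]
    exact hc.1
  have heq : (c.2 : ℕ) = c'.2 :=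
    le_antisymm (not_lt.1 (key hc' hc)) (not_lt.1 (key hc hc'))
  obtain ⟨i, b⟩ := c
  obtain ⟨i', b'⟩ := c'
  obtain rfl : i = i' := by
    have h1 := hc.2
    have h2 := hc'.2
    rw [heq] at h1
    exact hn (h1.symm.trans h2)
  obtain rfl : b = b' := Fin.ext heq
  rfl

/-- Going back from `x` to the last visit of `W`. -/
theorem ReturnsWithin.exists_block (h : ReturnsWithin σ W N) (x : X) :
    ∃ b r : ℕ, b < r ∧ (σ ^ (-(b : ℤ) - 1)) x ∈ returnLevel σ W r := by
  classical
  have hex := h.exists_backward x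
  set j := Nat.find hex with hj
  obtain ⟨hj0, hjm⟩ := Nat.find_spec hex
  rw [← hj] at hj0 hjm
  have hpt : -((j - 1 : ℕ) : ℤ) - 1 = -j := by omega
  refine ⟨j - 1, returnTime σ W ((σ ^ (-j : ℤ)) x), ?_, ?_⟩
  -- A return before time `j` would be a visit closer to `x` than the last one.
  · by_contra! hlt
    have hpos := h.returnTime_pos ((σ ^ (-j : ℤ)) x)
    have hm := h.returnTime_mem ((σ ^ (-j : ℤ)) x)
    set r := returnTime σ W ((σ ^ (-j : ℤ)) x)
    rw [zpow_eq_of_eq_add σ (a := -((j - r : ℕ) : ℤ)) (by omega)] at hm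
    exact Nat.find_min hex (m := j - r) (by omega) ⟨by omega, hm⟩
  · rw [hpt]
    exact ⟨hjm, rfl⟩

/-- A block which contains an interior point of an orbit segment from `W` to `W` is contained in
that segment. -/
theorem ReturnsWithin.block_subset (h : ReturnsWithin σ W N) {x : X} {b r : ℕ} (hbr : b < r)
    (hx : (σ ^ (-(b : ℤ) - 1)) x ∈ returnLevel σ W r) {p q : ℤ} (hp : 0 < p) (hq : 0 ≤ q)
    (hpx : (σ ^ (-p)) x ∈ W) (hqx : (σ ^ q) x ∈ W) : (b : ℤ) + 1 ≤ p ∧ r ≤ b + 1 + q := by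
  have hno := (h.mem_returnLevel.1 hx).2.2.2
  constructor
  · by_contra! hlt
    refine hno (b + 1 - p) (by omega) (by omega) ?_
    rwa [zpow_eq_of_eq_add σ (a := -p) (by omega)]
  · by_contra! hlt
    refine hno (b + 1 + q) (by omega) (by omega) ?_
    rwa [zpow_eq_of_eq_add σ (a := q) (by omega)]

/-- The members of the family `n` include the first return times at all visits during the orbit
segment of length `q` from `y`, if the return happens within the segment. -/
def CoversReturns (σ : X ≃ₜ X) (W : Set X) (n : ι → ℕ) (q : ℕ) (y : X) : Prop :=
  ∀ j : ℕ, (σ ^ (j : ℤ)) y ∈ W → j + returnTime σ W ((σ ^ (j : ℤ)) y) ≤ q →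
    ∃ i, n i = returnTime σ W ((σ ^ (j : ℤ)) y)

/-- The members of the family `n` include all first return times up to any of its members. -/
def IsReturnFamily (σ : X ≃ₜ X) (W : Set X) (n : ι → ℕ) : Prop :=
  ∀ i, ∀ y ∈ W, returnTime σ W y ≤ n i → ∃ i', n i' = returnTime σ W y

theorem IsReturnFamily.coversReturns (hf : IsReturnFamily σ W n) (i : ι) (y : X) :
    CoversReturns σ W n (n i) y :=
  fun _ hj hle => hf i _ hj (le_trans (Nat.le_add_left _ _) hle)

/-- A return time equal to `q` can occur within the segment only at its start, which would put `y`
in the level. Hence on the boundary the shorter return times suffice, as gluing to earlier stages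
requires. -/
theorem CoversReturns.of_lt {q : ℕ} {y : X} (hy : y ∉ returnLevel σ W q)
    (hf : ∀ w ∈ W, returnTime σ W w < q → ∃ i, n i = returnTime σ W w) :
    CoversReturns σ W n q y := by
  intro j hj hle
  refine hf _ hj (lt_of_le_of_ne (le_trans (Nat.le_add_left _ _) hle) fun heq => hy ?_)
  obtain rfl : j = 0 := by omega
  exact ⟨hj, heq⟩

theorem ReturnsWithin.exists_blockPosition (h : ReturnsWithin σ W N) {q : ℕ} {y : X}
    (hf : CoversReturns σ W n q y) (hy : y ∈ W) (hq : (σ ^ (q : ℤ)) y ∈ W) (b : Fin q) :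
    ∃ c, IsBlockPosition σ W n ((σ ^ (b + 1 : ℤ)) y) c := by
  obtain ⟨b', r, hbr, hm⟩ := h.exists_block ((σ ^ (b + 1 : ℤ)) y)
  have hle := h.block_subset hbr hm (p := b + 1) (q := q - b - 1) (by omega) (by omega)
    (by rw [zpow_eq_of_eq_add σ (a := 0) (by omega)]; exact hy)
    (by rw [zpow_eq_of_eq_add σ (a := q) (by omega)]; exact hq)
  have hpt : (σ ^ (-(b' : ℤ) - 1)) ((σ ^ (b + 1 : ℤ)) y) = (σ ^ ((b - b' : ℕ) : ℤ)) y :=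
    zpow_eq_of_eq_add σ (by omega) y
  have hm' := hm
  rw [hpt] at hm'
  obtain ⟨i', hi'⟩ := hf _ hm'.1 (by rw [hm'.2]; omega)
  obtain rfl : n i' = r := hi'.trans hm'.2
  exact ⟨⟨i', b', hbr⟩, hm⟩

end Dynamics

/-! ### The kernel of a family of matrix functions -/

section Kernel

variable {X : Type u} [TopologicalSpace X] {σ : X ≃ₜ X} {W : Set X} {N : ℕ}
  {ι : Type*} {n : ι → ℕ}

open Classical in
/-- The entry `(m + b, b)` of the matrix `f i w` for a block position `x = σ ^ (b + 1) w`, and `0`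
if `m` leads out of the block. -/
noncomputable def blockKernel (f : MatFun (fun i => ReturnSpace σ W (n i)) n) (m : ℤ) (x : X) :
    ℂ :=
  if h : ∃ c, IsBlockPosition σ W n x c then
    if hm : 0 ≤ m + h.choose.2 ∧ m + h.choose.2 < n h.choose.1 then
      f h.choose.1 ⟨_, subset_closure h.choose_spec⟩
        ⟨(m + h.choose.2).toNat, by omega⟩ h.choose.2
    else 0
  else 0

theorem ReturnsWithin.blockKernel_eq (h : ReturnsWithin σ W N) (hn : Function.Injective n)
    (f : MatFun (fun i => ReturnSpace σ W (n i)) n) (m : ℤ) {x : X} {c : Σ i, Fin (n i)}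
    (hc : IsBlockPosition σ W n x c) :
    blockKernel f m x = if hm : 0 ≤ m + c.2 ∧ m + c.2 < n c.1 then
      f c.1 ⟨_, subset_closure hc⟩ ⟨(m + c.2).toNat, by omega⟩ c.2 else 0 := by
  have hex : ∃ c, IsBlockPosition σ W n x c := ⟨c, hc⟩
  obtain rfl : c = hex.choose := h.blockPosition_unique hn hc hex.choose_spec
  rw [blockKernel, dif_pos hex]

/-- The kernel vanishes across visits to `W`. -/
theorem ReturnsWithin.blockKernel_eq_zero (h : ReturnsWithin σ W N) (hn : Function.Injective n)
    (f : MatFun (fun i => ReturnSpace σ W (n i)) n) {m v : ℤ} {x : X}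
    (hv : (0 ≤ v ∧ v < m) ∨ (m ≤ v ∧ v < 0)) (hx : (σ ^ v) x ∈ W) : blockKernel f m x = 0 := by
  by_cases hex : ∃ c, IsBlockPosition σ W n x c
  · obtain ⟨c, hc⟩ := hex
    rw [h.blockKernel_eq hn f m hc]
    refine dif_neg fun hm => ?_
    refine (h.mem_returnLevel.1 hc).2.2.2 (v + c.2 + 1) (by omega) (by omega) ?_
    rwa [zpow_eq_of_eq_add σ (a := v) (by omega)]
  · rw [blockKernel, dif_neg hex]

/-- At points with first return time `n i`, the entries of `f i` are values of the kernel. -/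
theorem ReturnsWithin.apply_eq_blockKernel (h : ReturnsWithin σ W N) (hn : Function.Injective n)
    (f : MatFun (fun i => ReturnSpace σ W (n i)) n) {i : ι} (y : ReturnSpace σ W (n i))
    (hy : y.1 ∈ returnLevel σ W (n i)) (a b : Fin (n i)) :
    f i y a b = blockKernel f (a - b) ((σ ^ (b + 1 : ℤ)) y.1) := by
  have hpt : (σ ^ (-(b : ℤ) - 1)) ((σ ^ (b + 1 : ℤ)) y.1) = y.1 := by
    rw [zpow_eq_of_eq_add σ (a := 0) (by omega)]; rfl
  have hc : IsBlockPosition σ W n ((σ ^ (b + 1 : ℤ)) y.1) ⟨i, b⟩ := by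
    rw [IsBlockPosition]; dsimp only; rwa [hpt]
  rw [h.blockKernel_eq hn f _ hc, dif_pos (by dsimp only; omega)]
  simp only [hpt, sub_add_cancel, Int.toNat_natCast, Fin.eta]

/-- The compatibility of `f` at the index `i`: all entries of `f i` are values of the kernel. -/
def IsKernelAt (f : MatFun (fun i => ReturnSpace σ W (n i)) n) (i : ι) : Prop :=
  ∀ (y : ReturnSpace σ W (n i)) (a b : Fin (n i)),
    f i y a b = blockKernel f (a - b) ((σ ^ (b + 1 : ℤ)) y.1)

/-- Compatibility extends the formula for the kernel from the return level to its closure. Out of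
the range of the matrix the kernel is still zero, because the ends of the segment remain visits to
`W`. -/
theorem ReturnsWithin.blockKernel_eq_of_isKernelAt (h : ReturnsWithin σ W N) (hW : IsClosed W)
    (hn : Function.Injective n) {f : MatFun (fun i => ReturnSpace σ W (n i)) n} {i : ι}
    (hf : IsKernelAt f i) (m : ℤ) (b : Fin (n i)) {x : X}
    (hx : (σ ^ (-(b : ℤ) - 1)) x ∈ closure (returnLevel σ W (n i))) :
    blockKernel f m x = if hm : 0 ≤ m + b ∧ m + b < n i then
      f i ⟨_, hx⟩ ⟨(m + b).toNat, by omega⟩ b else 0 := by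
  have hxW := h.mem_of_mem_closure hW hx
  rw [zpow_eq_of_eq_add σ rfl] at hxW
  split_ifs with hm
  · rw [hf, zpow_eq_of_eq_add σ (a := 0) (by omega)]
    congr 1
    simp only
    omega
  · rcases lt_or_ge (m + b) 0 with hlt | hge
    · exact h.blockKernel_eq_zero hn f (v := -(b : ℤ) - 1) (by omega) hxW.1
    · exact h.blockKernel_eq_zero hn f (by omega) hxW.2

/-- The kernel is continuous along maps into the union of the blocks at compatible indices. -/
theorem ReturnsWithin.continuous_blockKernel (h : ReturnsWithin σ W N) (hW : IsClosed W)
    [Finite ι] (hn : Function.Injective n) (f : MatFun (fun i => ReturnSpace σ W (n i)) n)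
    {T : Type*} [TopologicalSpace T] {τ : T → X} (hτ : Continuous τ)
    (hc : ∀ s, ∃ c : Σ i, Fin (n i), IsKernelAt f c.1 ∧ IsBlockPosition σ W n (τ s) c) (m : ℤ) :
    Continuous fun s => blockKernel f m (τ s) := by
  -- Using closures of levels makes these finitely many sets closed. They may overlap, but on each
  -- of them the kernel is a fixed entry of `f` or zero, so continuity can be checked piecewise.
  let S (c : Σ i, Fin (n i)) : Set T :=
    {s | IsKernelAt f c.1 ∧ (σ ^ (-(c.2 : ℤ) - 1)) (τ s) ∈ closure (returnLevel σ W (n c.1))}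
  refine (locallyFinite_of_finite S).continuous ?_ ?_ ?_
  · refine Set.eq_univ_of_forall fun s => ?_
    obtain ⟨c, h1, h2⟩ := hc s
    exact Set.mem_iUnion.2 ⟨c, h1, subset_closure h2⟩
  · intro c
    exact isClosed_const.inter
      (isClosed_closure.preimage ((σ ^ (-(c.2 : ℤ) - 1)).continuous.comp hτ))
  · intro c
    rw [continuousOn_iff_continuous_domRestrict]
    have hrw : (S c).domRestrict (fun s => blockKernel f m (τ s)) = fun s : S c =>
        if hm : 0 ≤ m + c.2 ∧ m + c.2 < n c.1 then
          f c.1 ⟨_, s.2.2⟩ ⟨(m + c.2).toNat, by omega⟩ c.2 else 0 := by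
      funext s
      exact h.blockKernel_eq_of_isKernelAt hW hn s.2.1 m c.2 s.2.2
    rw [hrw]
    split_ifs with hm
    · refine Continuous.matrix_elem ((f c.1).continuous.comp ?_) _ _
      exact Continuous.subtype_mk
        ((σ ^ (-(c.2 : ℤ) - 1)).continuous.comp (hτ.comp continuous_subtype_val)) _
    · exact continuous_const

/-- Restriction to a subfamily which still contains the block of `x` keeps the kernel. -/
theorem ReturnsWithin.blockKernel_comp (h : ReturnsWithin σ W N) (hn : Function.Injective n)
    {κ : Type*} {e : κ → ι} (he : Function.Injective e)
    (f : MatFun (fun i => ReturnSpace σ W (n i)) n) (m : ℤ) {x : X} {c : Σ k, Fin (n (e k))}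
    (hc : IsBlockPosition σ W (fun k => n (e k)) x c) :
    blockKernel (n := fun k => n (e k)) (fun k => f (e k)) m x = blockKernel f m x := by
  rw [h.blockKernel_eq (hn.comp he) _ m hc,
    h.blockKernel_eq hn f m (c := ⟨e c.1, c.2⟩) hc]
  rfl

end Kernel

/-! ## Block diagonal matrices -/

section BlockDiag

variable {q s : ℕ} {d : Fin s → ℕ}

theorem sum_finSigmaFinEquiv (k : (i : Fin s) × Fin (d i)) :
    (finSigmaFinEquiv k : ℕ) = ∑ j ∈ Finset.Iio k.1, d j + k.2 := by
  rw [finSigmaFinEquiv_apply]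
  congr 1
  refine Finset.sum_bij (fun i _ => Fin.castLE k.1.2.le i) ?_ ?_ ?_ ?_
  · intro i _
    rw [Finset.mem_Iio, Fin.lt_def]
    exact i.2
  · intro i _ j _ h
    exact Fin.castLE_injective _ h
  · intro j hj
    rw [Finset.mem_Iio, Fin.lt_def] at hj
    exact ⟨⟨j, hj⟩, Finset.mem_univ _, rfl⟩
  · intro i _
    rfl

/-- Every position `< ∑ k, d k` lies in a unique block. -/
theorem exists_block_index (hd : ∑ k, d k = q) (i : Fin q) :
    ∃ (k : Fin s) (a : Fin (d k)), (i : ℕ) = ∑ j ∈ Finset.Iio k, d j + a := by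
  subst hd
  refine ⟨(finSigmaFinEquiv.symm i).1, (finSigmaFinEquiv.symm i).2, ?_⟩
  rw [← sum_finSigmaFinEquiv, Equiv.apply_symm_apply]

theorem sum_Iio_add_le {k k' : Fin s} (h : k < k') :
    ∑ j ∈ Finset.Iio k, d j + d k ≤ ∑ j ∈ Finset.Iio k', d j := by
  rw [add_comm, ← Finset.sum_insert (by simp)]
  refine Finset.sum_le_sum_of_subset fun j hj => ?_
  simp only [Finset.mem_insert, Finset.mem_Iio] at hj ⊢
  rcases hj with rfl | hj
  · exact h
  · exact hj.trans h

theorem sum_Iic_eq (d : Fin s → ℕ) (k : Fin s) :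
    ∑ j ∈ Finset.Iic k, d j = ∑ j ∈ Finset.Iio k, d j + d k := by
  rw [add_comm, ← Finset.sum_insert (by simp), Finset.Iio_insert]

theorem isBlockDiag_of_entries {B : ∀ k, Mat (d k)} {M : Mat q} (hd : ∑ k, d k = q)
    (heq : ∀ (k : Fin s) (a b : Fin (d k)) (i j : Fin q),
      (i : ℕ) = ∑ j ∈ Finset.Iio k, d j + a → (j : ℕ) = ∑ j ∈ Finset.Iio k, d j + b →
        M i j = B k a b)
    (hne : ∀ (k k' : Fin s) (a : Fin (d k)) (b : Fin (d k')) (i j : Fin q), k ≠ k' →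
      (i : ℕ) = ∑ j ∈ Finset.Iio k, d j + a → (j : ℕ) = ∑ j ∈ Finset.Iio k', d j + b →
        M i j = 0) : IsBlockDiag d B M := by
  refine ⟨hd, ?_⟩
  subst hd
  ext i j
  obtain ⟨⟨k, a⟩, rfl⟩ := finSigmaFinEquiv.surjective i
  obtain ⟨⟨k', b⟩, rfl⟩ := finSigmaFinEquiv.surjective j
  have hr : Matrix.reindex (finSigmaFinEquiv.trans (finCongr rfl))
      (finSigmaFinEquiv.trans (finCongr rfl)) (Matrix.blockDiagonal' B)
      (finSigmaFinEquiv ⟨k, a⟩) (finSigmaFinEquiv ⟨k', b⟩) =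
        Matrix.blockDiagonal' B ⟨k, a⟩ ⟨k', b⟩ := by
    simp
  rw [hr]
  rcases eq_or_ne k k' with rfl | hk
  · rw [Matrix.blockDiagonal'_apply_eq]
    exact heq k a b _ _ (sum_finSigmaFinEquiv _) (sum_finSigmaFinEquiv _)
  · rw [Matrix.blockDiagonal'_apply_ne B _ _ hk]
    exact hne k k' a b _ _ hk (sum_finSigmaFinEquiv _) (sum_finSigmaFinEquiv _)

/-- Used to prove identities between matrices by cutting both sides into the same blocks. -/
theorem IsBlockDiag.unique {B : ∀ k, Mat (d k)} {M M' : Mat q} (h : IsBlockDiag d B M)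
    (h' : IsBlockDiag d B M') : M = M' := by
  obtain ⟨_, rfl⟩ := h
  obtain ⟨_, rfl⟩ := h'
  rfl

theorem IsBlockDiag.mul {B B' : ∀ k, Mat (d k)} {M M' : Mat q} (h : IsBlockDiag d B M)
    (h' : IsBlockDiag d B' M') : IsBlockDiag d (fun k => B k * B' k) (M * M') := by
  obtain ⟨hd, rfl⟩ := h
  obtain ⟨_, rfl⟩ := h'
  refine ⟨hd, ?_⟩
  rw [Matrix.blockDiagonal'_mul]
  exact Matrix.submatrix_mul_equiv _ _ _ (finSigmaFinEquiv.trans (finCongr hd)).symm _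

theorem IsBlockDiag.add {B B' : ∀ k, Mat (d k)} {M M' : Mat q} (h : IsBlockDiag d B M)
    (h' : IsBlockDiag d B' M') : IsBlockDiag d (fun k => B k + B' k) (M + M') := by
  obtain ⟨hd, rfl⟩ := h
  obtain ⟨_, rfl⟩ := h'
  refine ⟨hd, ?_⟩
  have : (fun k => B k + B' k) = B + B' := rfl
  rw [this, Matrix.blockDiagonal'_add]
  rfl

theorem IsBlockDiag.star {B : ∀ k, Mat (d k)} {M : Mat q} (h : IsBlockDiag d B M) :
    IsBlockDiag d (fun k => star (B k)) (star M) := by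
  obtain ⟨hd, rfl⟩ := h
  refine ⟨hd, ?_⟩
  simp only [Matrix.star_eq_conjTranspose]
  rw [← Matrix.blockDiagonal'_conjTranspose]
  rfl

theorem isBlockDiag_algebraMap (hd : ∑ k, d k = q) (c : ℂ) :
    IsBlockDiag d (fun k => algebraMap ℂ (Mat (d k)) c) (algebraMap ℂ (Mat q) c) := by
  refine ⟨hd, ?_⟩
  subst hd
  simp only [Matrix.algebraMap_eq_diagonal]
  rw [Matrix.blockDiagonal'_diagonal]
  ext i j
  simp [Matrix.diagonal_apply]

end BlockDiag

/-! ## Cutting orbit segments at the visits -/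

section Cut

variable {X : Type u} [TopologicalSpace X] {σ : X ≃ₜ X} {W : Set X} {N : ℕ}
  {ι : Type*} {n : ι → ℕ}

/-- The orbit segment of length `q` starting at `z` is the concatenation of the blocks of lengths
`n (t k)` which start at the points `p k`, with first return time `n (t k)`. -/
structure IsCut (σ : X ≃ₜ X) (W : Set X) (n : ι → ℕ) (q : ℕ) (z : X) {s : ℕ} (t : Fin s → ι)
    (p : ∀ k, ReturnSpace σ W (n (t k))) : Prop where
  sum_eq : ∑ k, n (t k) = q
  point_eq : ∀ k, (p k : X) = (σ ^ (∑ j ∈ Finset.Iio k, n (t j))) z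
  mem_level : ∀ k, (p k : X) ∈ returnLevel σ W (n (t k))

theorem IsCut.zpow_point {q : ℕ} {z : X} {s : ℕ} {t : Fin s → ι}
    {p : ∀ k, ReturnSpace σ W (n (t k))} (hc : IsCut σ W n q z t p) (k : Fin s) {i : ℤ} {a : ℤ}
    (hi : i = (∑ j ∈ Finset.Iio k, n (t j) : ℕ) + a) : (σ ^ i) z = (σ ^ a) (p k : X) := by
  rw [hc.point_eq, ← zpow_natCast, zpow_eq_of_eq_add σ (a := i) (by omega)]

theorem ReturnsWithin.isReturnSplitting_of_isCut (h : ReturnsWithin σ W N) {l : ℕ}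
    {n : Fin (l + 1) → ℕ} {q : ℕ} {z : X} {s : ℕ} {t : Fin s → Fin (l + 1)}
    {p : ∀ k, ReturnSpace σ W (n (t k))} (hc : IsCut σ W n q z t p) :
    IsReturnSplitting σ W n q z t p := by
  refine ⟨hc.sum_eq, hc.point_eq, fun r h1 hr => ⟨fun hm => ?_, ?_⟩⟩
  · obtain ⟨k, a, hka⟩ := exists_block_index hc.sum_eq ⟨r - 1, by omega⟩
    simp only at hka
    refine ⟨k, ?_⟩
    rw [sum_Iic_eq (fun j => n (t j))]
    rw [← zpow_natCast, hc.zpow_point k (a := a + 1) (by omega)] at hm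
    have hl := (h.mem_returnLevel.1 (hc.mem_level k)).2.2.2 (a + 1) (by omega)
    by_contra hne
    exact hl (by omega) hm
  · rintro ⟨k, rfl⟩
    rw [← zpow_natCast, sum_Iic_eq (fun j => n (t j)),
      hc.zpow_point k (a := n (t k)) (by push_cast; ring)]
    exact (h.mem_returnLevel.1 (hc.mem_level k)).2.2.1

/-- A piece as long as the whole segment is the whole segment. Thus over a boundary point every
piece has a smaller index. -/
theorem IsCut.eq_of_le {q : ℕ} {z : X} {s : ℕ} {t : Fin s → ι}
    {p : ∀ k, ReturnSpace σ W (n (t k))} (hc : IsCut σ W n q z t p) (k : Fin s)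
    (hk : q ≤ n (t k)) : n (t k) = q ∧ z ∈ returnLevel σ W q := by
  have hle : ∑ j ∈ Finset.Iic k, n (t j) ≤ q := by
    rw [← hc.sum_eq]
    exact Finset.sum_le_sum_of_subset (Finset.subset_univ _)
  rw [sum_Iic_eq (fun j => n (t j))] at hle
  have hq : n (t k) = q := by omega
  refine ⟨hq, ?_⟩
  have := hc.zpow_point k (i := 0) (a := 0) (by omega)
  rw [← hq, show z = (p k : X) from this]
  exact hc.mem_level k

/-- Orbit segments from `W` to `W` can be cut at the visits to `W`. -/
theorem ReturnsWithin.exists_isCut (h : ReturnsWithin σ W N) {q : ℕ} {z : X}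
    (hf : CoversReturns σ W n q z)
    (hz : z ∈ W) (hq : (σ ^ (q : ℤ)) z ∈ W) :
    ∃ (s : ℕ) (t : Fin s → ι) (p : ∀ k, ReturnSpace σ W (n (t k))), IsCut σ W n q z t p := by
  classical
  -- The cut is read off from the increasing enumeration `e` of the infinitely many visit times,
  -- with `e 0 = 0` and `e s = q`.
  set P : ℕ → Prop := fun r => (σ ^ (r : ℤ)) z ∈ W with hP
  have hinf : (Set.ofPred P).Infinite := by
    refine Set.infinite_of_not_bddAbove ?_
    rintro ⟨b, hb⟩
    obtain ⟨k, h0, _, hk⟩ := h ((σ ^ (b : ℤ)) z)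
    rw [zpow_eq_of_eq_add σ (a := ((k + b : ℕ) : ℤ)) (by omega)] at hk
    have := hb (show k + b ∈ Set.ofPred P from hk)
    omega
  set e := Nat.nth P with he
  have he0 : e 0 = 0 := by
    rw [he, Nat.nth_zero]
    refine Nat.le_zero.1 (Nat.sInf_le ?_)
    simpa [hP] using hz
  have hmono : StrictMono e := Nat.nth_strictMono hinf
  have hmem : ∀ k, (σ ^ (e k : ℤ)) z ∈ W := fun k => Nat.nth_mem_of_infinite hinf k
  set s := Nat.count P q with hs
  have hes : e s = q := Nat.nth_count (show P q from hq)
  have hlevel : ∀ k, (σ ^ (e k : ℤ)) z ∈ returnLevel σ W (e (k + 1) - e k) := by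
    intro k
    have hlt : e k < e (k + 1) := hmono (Nat.lt_succ_self k)
    rw [h.mem_returnLevel]
    refine ⟨hmem k, by omega, ?_, fun j hj hj' hm => ?_⟩
    · rw [zpow_eq_of_eq_add σ (a := e (k + 1)) (by omega)]
      exact hmem _
    -- A visit later than `e k` has an index greater than `k` in the enumeration, so it is not
    -- before `e (k + 1)`.
    · rw [zpow_eq_of_eq_add σ (a := ((j.toNat + e k : ℕ) : ℤ)) (by omega)] at hm
      have h1 := Nat.count_strict_mono (p := P) (show P (e k) from hmem k)
        (show e k < j.toNat + e k by omega)
      have h2 := Nat.nth_count (p := P) (show P (j.toNat + e k) from hm)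
      rw [Nat.count_nth_of_infinite hinf] at h1
      have h3 : e (k + 1) ≤ e (Nat.count P (j.toNat + e k)) := hmono.monotone h1
      rw [show e (Nat.count P (j.toNat + e k)) = j.toNat + e k from h2] at h3
      omega
  have hle : ∀ k : Fin s, e (k + 1) ≤ q := fun k => by
    rw [← hes]; exact hmono.monotone k.2
  have hidx : ∀ k : Fin s, ∃ i, n i = e (k + 1) - e k := fun k => by
    rw [← (hlevel k).2]
    refine hf _ (hmem k) ?_
    rw [(hlevel k).2, Nat.add_sub_cancel' (hmono (Nat.lt_succ_self k)).le]
    exact hle k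
  choose t ht using hidx
  have hsum : ∀ m : ℕ, ∑ k ∈ Finset.range m, (e (k + 1) - e k) = e m := fun m => by
    rw [Finset.sum_range_tsub hmono.monotone, he0, Nat.sub_zero]
  have hIio : ∀ k : Fin s, ∑ j ∈ Finset.Iio k, n (t j) = e k := fun k => by
    rw [← hsum k]
    simp only [ht]
    refine Finset.sum_bij (fun j _ => (j : ℕ)) ?_ ?_ ?_ ?_
    · intro j hj
      simpa using hj
    · intro j _ j' _ hjj
      exact Fin.ext hjj
    · intro j hj
      have hj' := Finset.mem_range.1 hj
      exact ⟨⟨j, hj'.trans k.2⟩, by simpa [Fin.lt_def] using hj', rfl⟩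
    · intro j _
      rfl
  have hlev : ∀ k : Fin s, (σ ^ (e k : ℤ)) z ∈ returnLevel σ W (n (t k)) := fun k => by
    rw [ht]; exact hlevel k
  refine ⟨s, t, fun k => ⟨(σ ^ (e k : ℤ)) z, subset_closure (hlev k)⟩, ?_, ?_, hlev⟩
  · simp only [ht]
    rw [Fin.sum_univ_eq_sum_range (fun k => e (k + 1) - e k), hsum, hes]
  · intro k
    rw [hIio]
    exact congrArg (fun g : X ≃ₜ X => g z) (zpow_natCast σ (e k))

/-- Along a cut, the matrix of kernel values is block diagonal. -/
theorem ReturnsWithin.isBlockDiag_blockKernel (h : ReturnsWithin σ W N)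
    (hn : Function.Injective n) (f : MatFun (fun i => ReturnSpace σ W (n i)) n) {q : ℕ} {z : X}
    {s : ℕ} {t : Fin s → ι} {p : ∀ k, ReturnSpace σ W (n (t k))} (hc : IsCut σ W n q z t p) :
    IsBlockDiag (fun k => n (t k)) (fun k => f (t k) (p k))
      (Matrix.of fun a b : Fin q => blockKernel f (a - b) ((σ ^ (b + 1 : ℤ)) z)) := by
  refine isBlockDiag_of_entries hc.sum_eq ?_ ?_
  · intro k a b i j hi hj
    rw [Matrix.of_apply, h.apply_eq_blockKernel hn f (p k) (hc.mem_level k) a b,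
      hc.zpow_point k (i := j + 1) (a := b + 1) (by omega)]
    congr 1
    omega
  · intro k k' a b i j hk hi hj
    rw [Matrix.of_apply, hc.zpow_point k' (i := j + 1) (a := b + 1) (by omega)]
    have hl := h.mem_returnLevel.1 (hc.mem_level k')
    rcases lt_or_gt_of_ne hk with hlt | hlt
    · have := sum_Iio_add_le (d := fun j => n (t j)) hlt
      -- A row in an earlier piece is separated from the column by the visit at the start of the
      -- column's piece; below, a row in a later piece is separated by the visit at its end.
      refine h.blockKernel_eq_zero hn f (v := -(b : ℤ) - 1) (by omega) ?_
      rw [zpow_eq_of_eq_add σ (a := 0) (by omega)]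
      exact hl.1
    · have := sum_Iio_add_le (d := fun j => n (t j)) hlt
      refine h.blockKernel_eq_zero hn f (v := n (t k') - (b : ℤ) - 1) (by omega) ?_
      rw [zpow_eq_of_eq_add σ (a := n (t k')) (by omega)]
      exact hl.2.2.1

end Cut

/-! ## The algebra of compatible families -/

section Compatible

variable {X : Type u} [TopologicalSpace X] {σ : X ≃ₜ X} {W : Set X} {N : ℕ}
  {ι : Type w} {n : ι → ℕ}

theorem IsKernelAt.isBlockDiag (h : ReturnsWithin σ W N) (hn : Function.Injective n)
    {f : MatFun (fun i => ReturnSpace σ W (n i)) n} {i : ι} (hf : IsKernelAt f i)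
    {y : ReturnSpace σ W (n i)} {s : ℕ} {t : Fin s → ι} {p : ∀ k, ReturnSpace σ W (n (t k))}
    (hc : IsCut σ W n (n i) y.1 t p) :
    IsBlockDiag (fun k => n (t k)) (fun k => f (t k) (p k)) (f i y) := by
  have heq : f i y = Matrix.of fun a b : Fin (n i) =>
      blockKernel f (a - b) ((σ ^ (b + 1 : ℤ)) y.1) := by
    ext a b
    exact hf y a b
  rw [heq]
  exact h.isBlockDiag_blockKernel hn f hc

/-- With `IsKernelAt.isBlockDiag` this makes compatibility equivalent to decomposition along cuts.
The kernel form yields continuity; the block form is visibly stable under the `*`-algebra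
operations. -/
theorem isKernelAt_of_isBlockDiag (h : ReturnsWithin σ W N) (hW : IsClosed W)
    (hn : Function.Injective n) (hfam : IsReturnFamily σ W n)
    {f : MatFun (fun i => ReturnSpace σ W (n i)) n} {i : ι}
    (hf : ∀ (y : ReturnSpace σ W (n i)) (s : ℕ) (t : Fin s → ι)
      (p : ∀ k, ReturnSpace σ W (n (t k))), IsCut σ W n (n i) y.1 t p →
        IsBlockDiag (fun k => n (t k)) (fun k => f (t k) (p k)) (f i y)) :
    IsKernelAt f i := by
  intro y a b
  have hy := h.mem_of_mem_closure hW y.2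
  obtain ⟨s, t, p, hc⟩ := h.exists_isCut (hfam.coversReturns i y.1) hy.1 hy.2
  rw [(hf y s t p hc).unique (h.isBlockDiag_blockKernel hn f hc), Matrix.of_apply]

/-- The families `f` whose entries are values of the kernel: over the boundaries of the return
spaces they decompose along the visits to `W`. -/
noncomputable def compatAlg (h : ReturnsWithin σ W N) (hW : IsClosed W) (hn : Function.Injective n)
    (hfam : IsReturnFamily σ W n) :
    StarSubalgebra ℂ (MatFun (fun i => ReturnSpace σ W (n i)) n) where
  carrier := {f | ∀ i, IsKernelAt f i}
  mul_mem' hf hg i := isKernelAt_of_isBlockDiag h hW hn hfam fun _ _ _ _ hc =>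
    ((hf i).isBlockDiag h hn hc).mul ((hg i).isBlockDiag h hn hc)
  add_mem' hf hg i := isKernelAt_of_isBlockDiag h hW hn hfam fun _ _ _ _ hc =>
    ((hf i).isBlockDiag h hn hc).add ((hg i).isBlockDiag h hn hc)
  algebraMap_mem' c _ := isKernelAt_of_isBlockDiag h hW hn hfam fun _ _ _ _ hc =>
    isBlockDiag_algebraMap hc.sum_eq c
  star_mem' hf i := isKernelAt_of_isBlockDiag h hW hn hfam fun _ _ _ _ hc =>
    ((hf i).isBlockDiag h hn hc).star

/-- The extension of compatible families to the boundary of another return space, all of whose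
orbit segments are cut into blocks of the family. -/
noncomputable def glueHom (h : ReturnsWithin σ W N) (hW : IsClosed W) (hn : Function.Injective n)
    (hfam : IsReturnFamily σ W n) [Finite ι] {q : ℕ}
    (hq : ∀ w ∈ W, returnTime σ W w < q → ∃ i, n i = returnTime σ W w) :
    compatAlg h hW hn hfam →⋆ₐ[ℂ] C(returnBoundary σ W q, Mat q) :=
  -- Each algebraic law is checked at one boundary point, where both sides have the same blocks
  -- along this cut.
  have cut (y : returnBoundary σ W q) :=
    h.exists_isCut (CoversReturns.of_lt y.2 hq) (h.mem_of_mem_closure hW y.1.2).1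
      (h.mem_of_mem_closure hW y.1.2).2
  { toFun f := ⟨fun y => Matrix.of fun a b : Fin q =>
      blockKernel f.1 (a - b) ((σ ^ (b + 1 : ℤ)) y.1.1), by
        refine continuous_matrix fun a b => ?_
        refine h.continuous_blockKernel hW hn f.1
          ((σ ^ (b + 1 : ℤ)).continuous.comp
            (continuous_subtype_val.comp continuous_subtype_val)) (fun y => ?_) _
        have hy := h.mem_of_mem_closure hW y.1.2
        obtain ⟨c, hc⟩ := h.exists_blockPosition (CoversReturns.of_lt y.2 hq) hy.1 hy.2 b
        exact ⟨c, f.2 c.1, hc⟩⟩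
    map_one' := by
      ext1 y
      obtain ⟨s, t, p, hc⟩ := cut y
      refine (h.isBlockDiag_blockKernel hn _ hc).unique ?_
      simpa using isBlockDiag_algebraMap hc.sum_eq 1
    map_mul' f g := by
      ext1 y
      obtain ⟨s, t, p, hc⟩ := cut y
      exact (h.isBlockDiag_blockKernel hn _ hc).unique
        ((h.isBlockDiag_blockKernel hn f.1 hc).mul (h.isBlockDiag_blockKernel hn g.1 hc))
    map_zero' := by
      ext1 y
      obtain ⟨s, t, p, hc⟩ := cut y
      refine (h.isBlockDiag_blockKernel hn _ hc).unique ?_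
      simpa using isBlockDiag_algebraMap hc.sum_eq 0
    map_add' f g := by
      ext1 y
      obtain ⟨s, t, p, hc⟩ := cut y
      exact (h.isBlockDiag_blockKernel hn _ hc).unique
        ((h.isBlockDiag_blockKernel hn f.1 hc).add (h.isBlockDiag_blockKernel hn g.1 hc))
    commutes' c := by
      ext1 y
      obtain ⟨s, t, p, hc⟩ := cut y
      exact (h.isBlockDiag_blockKernel hn _ hc).unique (isBlockDiag_algebraMap hc.sum_eq c)
    map_star' f := by
      ext1 y
      obtain ⟨s, t, p, hc⟩ := cut y
      exact (h.isBlockDiag_blockKernel hn _ hc).unique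
        (h.isBlockDiag_blockKernel hn f.1 hc).star }

theorem glueHom_apply (h : ReturnsWithin σ W N) (hW : IsClosed W) (hn : Function.Injective n)
    (hfam : IsReturnFamily σ W n) [Finite ι] {q : ℕ}
    (hq : ∀ w ∈ W, returnTime σ W w < q → ∃ i, n i = returnTime σ W w)
    (f : compatAlg h hW hn hfam) (y : returnBoundary σ W q) :
    glueHom h hW hn hfam hq f y = Matrix.of fun a b : Fin q =>
      blockKernel f.1 (a - b) ((σ ^ (b + 1 : ℤ)) y.1.1) := rfl

variable {κ : Type v} {e : κ → ι}

/-- All blocks inside a segment of a member of the subfamily belong to the subfamily, so the two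
kernels agree there. -/
theorem isKernelAt_comp (h : ReturnsWithin σ W N) (hW : IsClosed W) (hn : Function.Injective n)
    (he : Function.Injective e) (hfam : IsReturnFamily σ W (fun k => n (e k)))
    (f : MatFun (fun i => ReturnSpace σ W (n i)) n) (k : κ) :
    IsKernelAt (n := fun k => n (e k)) (fun k => f (e k)) k ↔ IsKernelAt f (e k) := by
  refine forall_congr' fun y => forall_congr' fun a => forall_congr' fun b => ?_
  have hy := h.mem_of_mem_closure hW y.2
  obtain ⟨c, hc⟩ := h.exists_blockPosition (hfam.coversReturns k y.1) hy.1 hy.2 b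
  rw [h.blockKernel_comp hn he f _ hc]

/-- Compatibility holds automatically on the return level, so only the boundary gives a condition,
and the kernel there involves only the earlier spaces. -/
theorem isKernelAt_iff_glueHom (h : ReturnsWithin σ W N) (hW : IsClosed W)
    (hn : Function.Injective n) (he : Function.Injective e) [Finite κ]
    (hfam : IsReturnFamily σ W (fun k => n (e k)))
    (f : MatFun (fun i => ReturnSpace σ W (n i)) n) {i : ι}
    (hq : ∀ w ∈ W, returnTime σ W w < n i → ∃ k, n (e k) = returnTime σ W w)
    (hf : (fun k => f (e k)) ∈ compatAlg h hW (hn.comp he) hfam) :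
    IsKernelAt f i ↔
      glueHom h hW (hn.comp he) hfam hq ⟨_, hf⟩ = (f i).restrict (returnBoundary σ W (n i)) := by
  have key : ∀ (y : returnBoundary σ W (n i)) (a b : Fin (n i)),
      glueHom h hW (hn.comp he) hfam hq ⟨_, hf⟩ y a b =
        blockKernel f (a - b) ((σ ^ (b + 1 : ℤ)) y.1.1) := by
    intro y a b
    have hy := h.mem_of_mem_closure hW y.1.2
    obtain ⟨c, hc⟩ := h.exists_blockPosition (CoversReturns.of_lt y.2 hq) hy.1 hy.2 b
    rw [glueHom_apply, Matrix.of_apply]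
    exact h.blockKernel_comp hn he f _ hc
  constructor
  · intro hk
    ext y a b
    rw [key, ContinuousMap.restrict_apply, hk]
  · intro hg y a b
    by_cases hy : y.1 ∈ returnLevel σ W (n i)
    · exact h.apply_eq_blockKernel hn f y hy a b
    · have := key ⟨y, hy⟩ a b
      rw [hg] at this
      exact this

end Compatible

/-! ### The composition sequence of the compatible families -/

section Sequence

variable {X : Type u} [TopologicalSpace X] {σ : X ≃ₜ X} {W : Set X} {N : ℕ}
  {l : ℕ} {n : Fin (l + 1) → ℕ}

theorem isReturnFamily_Iic (hn : StrictMono n) (hr : ∀ y ∈ W, ∃ i, n i = returnTime σ W y)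
    (i : Fin (l + 1)) : IsReturnFamily σ W (fun j : Set.Iic i => n j) := by
  intro j y hy hle
  obtain ⟨i', hi'⟩ := hr y hy
  rw [← hi'] at hle
  exact ⟨⟨i', (hn.le_iff_le.1 hle).trans j.2⟩, hi'⟩

theorem exists_Iic_castSucc (hn : StrictMono n) (hr : ∀ y ∈ W, ∃ i, n i = returnTime σ W y)
    (i : Fin l) : ∀ w ∈ W, returnTime σ W w < n i.succ →
      ∃ j : Set.Iic i.castSucc, n j = returnTime σ W w := by
  intro w hw hlt
  obtain ⟨i', hi'⟩ := hr w hw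
  rw [← hi'] at hlt
  exact ⟨⟨i', Fin.le_castSucc_iff.2 (hn.lt_iff_lt.1 hlt)⟩, hi'⟩

/-- The composition sequence of the algebra of compatible families. -/
noncomputable def compatSequence (h : ReturnsWithin σ W N) (hW : IsClosed W) (hn : StrictMono n)
    (hr : ∀ y ∈ W, ∃ i, n i = returnTime σ W y) :
    DSHSequence (fun i => ReturnSpace σ W (n i)) n (fun i => returnBoundary σ W (n i)) where
  stage i := compatAlg h hW (hn.injective.comp Subtype.val_injective) (isReturnFamily_Iic hn hr i)
  glue i := glueHom h hW (hn.injective.comp Subtype.val_injective)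
    (isReturnFamily_Iic hn hr i.castSucc) (exists_Iic_castSucc hn hr i)
  stage_zero := by
    -- For the shortest return time there is no boundary: a point of the closure returns by that
    -- time, and no point of `W` returns earlier.
    refine eq_top_iff.2 fun f _ j y a b => ?_
    refine h.apply_eq_blockKernel (hn.injective.comp Subtype.val_injective) f y ?_ a b
    have hy := h.mem_of_mem_closure hW y.2
    obtain ⟨i', hi'⟩ := hr _ hy.1
    refine ⟨hy.1, le_antisymm ?_ ?_⟩
    · obtain ⟨w, hw⟩ := closure_nonempty_iff.1 ⟨y.1, y.2⟩
      exact_mod_cast returnTime_le_of_mem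
        (by exact_mod_cast (h.mem_returnLevel.1 hw).2.1) hy.2
    · rw [← hi']
      exact hn.monotone (j.2.trans (Fin.zero_le i'))
  glue_diag i y := by
    have hy := h.mem_of_mem_closure hW y.1.2
    obtain ⟨s, t, p, hc⟩ := h.exists_isCut
      (CoversReturns.of_lt y.2 (exists_Iic_castSucc hn hr i)) hy.1 hy.2
    exact ⟨s, t, p, fun f => h.isBlockDiag_blockKernel
      (hn.injective.comp Subtype.val_injective) f.1 hc⟩
  stage_succ i f := by
    have hle : i.castSucc ≤ i.succ := i.castSucc_lt_succ.le
    let e : Set.Iic i.castSucc → Set.Iic i.succ := fun j => ⟨j.1, j.2.trans hle⟩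
    have he : Function.Injective e := fun j j' hj => Subtype.ext (congrArg (fun k => k.1) hj)
    have hn' : Function.Injective (fun j : Set.Iic i.succ => n j) :=
      hn.injective.comp Subtype.val_injective
    have hfam := isReturnFamily_Iic hn hr i.castSucc
    -- Adding the index `i + 1` does not affect compatibility at the earlier indices, and at the new
    -- index compatibility is the gluing condition.
    constructor
    · intro hf
      have h1 : (fun k => f (e k)) ∈ compatAlg h hW (hn'.comp he) hfam :=
        fun k => (isKernelAt_comp h hW hn' he hfam f k).2 (hf (e k))
      exact ⟨h1, (isKernelAt_iff_glueHom h hW hn' he hfam f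
        (i := ⟨i.succ, Set.mem_Iic.2 le_rfl⟩) (exists_Iic_castSucc hn hr i) h1).1 (hf _)⟩
    · rintro ⟨h1, h2⟩ ⟨j, hj⟩
      rcases (Set.mem_Iic.1 hj).eq_or_lt with rfl | hlt
      · exact (isKernelAt_iff_glueHom h hW hn' he hfam f
          (i := ⟨i.succ, Set.mem_Iic.2 le_rfl⟩) (exists_Iic_castSucc hn hr i) h1).2 h2
      · exact (isKernelAt_comp h hW hn' he hfam f
          ⟨j, Set.mem_Iic.2 (Fin.le_castSucc_iff.2 hlt)⟩).1 (h1 _)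

theorem isReturnFamily_of_exists (hr : ∀ y ∈ W, ∃ i, n i = returnTime σ W y) :
    IsReturnFamily σ W n := fun _ y hy _ => hr y hy

theorem isDSH_compatAlg [CompactSpace X] [T2Space X] (h : ReturnsWithin σ W N) (hW : IsClosed W)
    (hn : StrictMono n) (hr : ∀ y ∈ W, ∃ i, n i = returnTime σ W y) (hpos : ∀ i, 0 < n i) :
    IsDSH (fun i => ReturnSpace σ W (n i)) (fun i => returnBoundary σ W (n i)) n
      (compatAlg h hW hn.injective (isReturnFamily_of_exists hr)) := by
  refine ⟨fun i => isCompact_iff_compactSpace.1 isClosed_closure.isCompact,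
    fun i => inferInstance, fun i => h.isClosed_returnBoundary hW (hpos i), hpos,
    compatSequence h hW hn hr, fun f => ?_⟩
  have key := isKernelAt_comp (e := fun j : Set.Iic (Fin.last l) => j.1) h hW hn.injective
    Subtype.val_injective (isReturnFamily_Iic hn hr (Fin.last l)) f
  exact ⟨fun hf j => (key j).2 (hf j.1), fun hf i => (key ⟨i, Fin.le_last i⟩).1 (hf _)⟩

theorem exists_position (h : ReturnsWithin σ W N) (hr : ∀ y ∈ W, ∃ i, n i = returnTime σ W y)
    (x : X) : ∃ c, IsBlockPosition σ W n x c := by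
  obtain ⟨b, r, hbr, hm⟩ := h.exists_block x
  obtain ⟨i, hi⟩ := hr _ hm.1
  obtain rfl : n i = r := hi.trans hm.2
  exact ⟨⟨i, b, hbr⟩, hm⟩

end Sequence

/-! ## Matrix entries of operators on `ℓ²(X × ℤ)` -/

section Entries

variable {X : Type u}

open Classical in
/-- The matrix entry at `(p, q)` of an operator on `ℓ²(X × ℤ)`. -/
noncomputable def opEntry (T : RegRepSpace X →L[ℂ] RegRepSpace X) (p q : X × ℤ) : ℂ :=
  T (lp.single 2 q 1) p

open Classical in
theorem opEntry_one (p q : X × ℤ) :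
    opEntry (1 : RegRepSpace X →L[ℂ] RegRepSpace X) p q = if p = q then 1 else 0 := by
  simp [opEntry, Pi.single_apply]

theorem opEntry_add (S T : RegRepSpace X →L[ℂ] RegRepSpace X) (p q : X × ℤ) :
    opEntry (S + T) p q = opEntry S p q + opEntry T p q := rfl

theorem opEntry_smul (c : ℂ) (T : RegRepSpace X →L[ℂ] RegRepSpace X) (p q : X × ℤ) :
    opEntry (c • T) p q = c * opEntry T p q := rfl

theorem opEntry_sum {ι : Type*} (s : Finset ι) (T : ι → RegRepSpace X →L[ℂ] RegRepSpace X)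
    (p q : X × ℤ) : opEntry (∑ i ∈ s, T i) p q = ∑ i ∈ s, opEntry (T i) p q := by
  classical
  induction s using Finset.induction_on with
  | empty => rfl
  | insert i s hi ih => rw [Finset.sum_insert hi, Finset.sum_insert hi, opEntry_add, ih]

theorem opEntry_star (T : RegRepSpace X →L[ℂ] RegRepSpace X) (p q : X × ℤ) :
    opEntry (star T) p q = star (opEntry T q p) := by
  classical
  have h := lp.inner_single_left (𝕜 := ℂ) p (1 : ℂ) (star T (lp.single 2 q 1))
  rw [ContinuousLinearMap.star_eq_adjoint, ContinuousLinearMap.adjoint_inner_right,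
    lp.inner_single_right] at h
  simp only [RCLike.inner_apply, map_one, mul_one, one_mul] at h
  rw [opEntry, opEntry, ContinuousLinearMap.star_eq_adjoint, ← starRingEnd_apply]
  exact (by convert h.symm)

theorem norm_opEntry_le (T : RegRepSpace X →L[ℂ] RegRepSpace X) (p q : X × ℤ) :
    ‖opEntry T p q‖ ≤ ‖T‖ := by
  classical
  refine (lp.norm_apply_le_norm (by simp) _ p).trans ((T.le_opNorm _).trans ?_)
  rw [lp.norm_single (by simp)]
  simp

theorem continuous_opEntry (p q : X × ℤ) :
    Continuous fun T : RegRepSpace X →L[ℂ] RegRepSpace X => opEntry T p q := by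
  refine (LipschitzWith.of_dist_le_mul (K := 1) fun S T => ?_).continuous
  rw [dist_eq_norm, dist_eq_norm, NNReal.coe_one, one_mul]
  exact norm_opEntry_le (S - T) p q

/-- The coordinate of `R ξ` at `p` is the inner product of `star R (e_p)` with `ξ`, and the
coordinates of `star R (e_p)` are conjugate entries of `R`. -/
theorem opEntry_injective {S T : RegRepSpace X →L[ℂ] RegRepSpace X}
    (h : ∀ p q, opEntry S p q = opEntry T p q) : S = T := by
  classical
  ext ξ p
  have key : ∀ R : RegRepSpace X →L[ℂ] RegRepSpace X,
      R ξ p = inner ℂ (star R (lp.single 2 p 1)) ξ := by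
    intro R
    rw [ContinuousLinearMap.star_eq_adjoint, ContinuousLinearMap.adjoint_inner_left,
      lp.inner_single_left]
    simp
  rw [key, key]
  congr 1
  ext q
  have := congrArg star (h p q)
  rw [← opEntry_star, ← opEntry_star] at this
  simp only [opEntry] at this
  convert this

variable [TopologicalSpace X]

/-- Operators on `ℓ²(X × ℤ)` which preserve the fibres over `X`, are equivariant under the orbit
relation, have continuous entries, and respect the decomposition of orbits at the visits to `W`. -/
structure IsOrbitLocal (σ : X ≃ₜ X) (W : Set X) (T : RegRepSpace X →L[ℂ] RegRepSpace X) :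
    Prop where
  off : ∀ p q : X × ℤ, p.1 ≠ q.1 → opEntry T p q = 0
  equivariant : ∀ (x : X) (k l j : ℤ),
    opEntry T ((σ ^ j) x, k) ((σ ^ j) x, l) = opEntry T (x, k + j) (x, l + j)
  continuous : ∀ k l : ℤ, Continuous fun x => opEntry T (x, k) (x, l)
  -- A visit at time `v` separates the times `≤ v` from the times `> v`, so a visit time is the last
  -- time of its block.
  vanish : ∀ (x : X) (k l v : ℤ), (k ≤ v ∧ v < l) ∨ (l ≤ v ∧ v < k) → (σ ^ v) x ∈ W →
    opEntry T (x, k) (x, l) = 0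

variable {σ : X ≃ₜ X} {W : Set X}

theorem isOrbitLocal_one : IsOrbitLocal σ W 1 where
  off p q h := by
    classical
    rw [opEntry_one, if_neg fun hpq => h (congrArg Prod.fst hpq)]
  equivariant x k l j := by
    classical
    simp [opEntry_one]
  continuous k l := by
    classical
    simp only [opEntry_one, Prod.mk.injEq, true_and]
    exact continuous_const
  vanish x k l v h _ := by
    classical
    rw [opEntry_one, if_neg fun hkl => by
      have := congrArg Prod.snd hkl
      simp only at this
      omega]

theorem IsOrbitLocal.add {S T : RegRepSpace X →L[ℂ] RegRepSpace X} (hS : IsOrbitLocal σ W S)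
    (hT : IsOrbitLocal σ W T) : IsOrbitLocal σ W (S + T) where
  off p q h := by rw [opEntry_add, hS.off p q h, hT.off p q h, add_zero]
  equivariant x k l j := by simp only [opEntry_add, hS.equivariant, hT.equivariant]
  continuous k l := (hS.continuous k l).add (hT.continuous k l)
  vanish x k l v h hv := by
    rw [opEntry_add, hS.vanish x k l v h hv, hT.vanish x k l v h hv, add_zero]

theorem IsOrbitLocal.smul {T : RegRepSpace X →L[ℂ] RegRepSpace X} (c : ℂ)
    (hT : IsOrbitLocal σ W T) : IsOrbitLocal σ W (c • T) where
  off p q h := by rw [opEntry_smul, hT.off p q h, mul_zero]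
  equivariant x k l j := by simp only [opEntry_smul, hT.equivariant]
  continuous k l := continuous_const.mul (hT.continuous k l)
  vanish x k l v h hv := by rw [opEntry_smul, hT.vanish x k l v h hv, mul_zero]

/-- Multiplication from the left by the weighted shift with weight `φ` and step `d`. -/
theorem IsOrbitLocal.shift_mul {S T : RegRepSpace X →L[ℂ] RegRepSpace X} {φ : X → ℂ}
    (hφ : Continuous φ) {d : ℤ}
    (hd : ∀ (x : X) (v : ℤ), (0 ≤ v ∧ v < d) ∨ (d ≤ v ∧ v < 0) → (σ ^ v) x ∈ W → φ x = 0)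
    (hS : ∀ ξ p, S ξ p = φ ((σ ^ p.2) p.1) * ξ (p.1, p.2 + d)) (hT : IsOrbitLocal σ W T) :
    IsOrbitLocal σ W (S * T) := by
  have key : ∀ p q, opEntry (S * T) p q =
      φ ((σ ^ p.2) p.1) * opEntry T (p.1, p.2 + d) q := fun p q => hS _ p
  refine ⟨fun p q h => ?_, fun x k l j => ?_, fun k l => ?_, fun x k l v h hv => ?_⟩
  · rw [key, hT.off (p.1, p.2 + d) q h, mul_zero]
  · rw [key, key, hT.equivariant, zpow_eq_of_eq_add σ rfl, add_right_comm]
  · simp only [key]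
    exact (hφ.comp (σ ^ k).continuous).mul (hT.continuous _ _)
  · rw [key]
    -- A visit separating `k` from `l` either separates `k + d` from `l`, where `T` vanishes, or `k`
    -- from `k + d`, where the weight does.
    by_cases hs : (k + d ≤ v ∧ v < l) ∨ (l ≤ v ∧ v < k + d)
    · rw [hT.vanish x _ l v hs hv, mul_zero]
    · rw [hd _ (v - k) (by omega) (by rwa [zpow_eq_of_eq_add σ (a := v) (by omega)]), zero_mul]

/-- Entries are bounded by the operator norm, uniformly in the base point. Norm limits therefore
preserve the pointwise equations and, as uniform limits, the continuity of entries. -/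
theorem isClosed_isOrbitLocal : IsClosed {T | IsOrbitLocal σ W T} := by
  have h1 : IsClosed {T : RegRepSpace X →L[ℂ] RegRepSpace X |
      ∀ p q : X × ℤ, p.1 ≠ q.1 → opEntry T p q = 0} := by
    simp only [Set.ofPred_forall]
    exact isClosed_iInter fun p => isClosed_iInter fun q => isClosed_iInter fun _ =>
      isClosed_eq (continuous_opEntry p q) continuous_const
  have h2 : IsClosed {T : RegRepSpace X →L[ℂ] RegRepSpace X | ∀ (x : X) (k l j : ℤ),
      opEntry T ((σ ^ j) x, k) ((σ ^ j) x, l) = opEntry T (x, k + j) (x, l + j)} := by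
    simp only [Set.ofPred_forall]
    exact isClosed_iInter fun _ => isClosed_iInter fun _ => isClosed_iInter fun _ =>
      isClosed_iInter fun _ => isClosed_eq (continuous_opEntry _ _) (continuous_opEntry _ _)
  have h3 : IsClosed {T : RegRepSpace X →L[ℂ] RegRepSpace X | ∀ k l : ℤ,
      Continuous fun x => opEntry T (x, k) (x, l)} := by
    refine isClosed_of_closure_subset fun T hT k l => ?_
    refine continuous_of_uniform_approx_of_continuous fun u hu => ?_
    obtain ⟨ε, hε, hεu⟩ := Metric.mem_uniformity_dist.1 hu
    obtain ⟨S, hS, hST⟩ := Metric.mem_closure_iff.1 hT ε hε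
    refine ⟨_, hS k l, fun x => ?_⟩
    refine hεu (lt_of_le_of_lt ?_ hST)
    rw [dist_eq_norm, dist_eq_norm]
    exact norm_opEntry_le (T - S) (x, k) (x, l)
  have h4 : IsClosed {T : RegRepSpace X →L[ℂ] RegRepSpace X | ∀ (x : X) (k l v : ℤ),
      (k ≤ v ∧ v < l) ∨ (l ≤ v ∧ v < k) → (σ ^ v) x ∈ W → opEntry T (x, k) (x, l) = 0} := by
    simp only [Set.ofPred_forall]
    exact isClosed_iInter fun _ => isClosed_iInter fun _ => isClosed_iInter fun _ =>
      isClosed_iInter fun _ => isClosed_iInter fun _ => isClosed_iInter fun _ =>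
      isClosed_eq (continuous_opEntry _ _) continuous_const
  convert h1.inter (h2.inter (h3.inter h4)) using 1
  ext T
  exact ⟨fun h => ⟨h.1, h.2, h.3, h.4⟩, fun h => ⟨h.1, h.2.1, h.2.2.1, h.2.2.2⟩⟩

/-- Products of local operators are given by matrix products over orbit segments from `W` to `W`. -/
theorem IsOrbitLocal.opEntry_mul {T : RegRepSpace X →L[ℂ] RegRepSpace X}
    (hT : IsOrbitLocal σ W T) (S : RegRepSpace X →L[ℂ] RegRepSpace X) {r : ℕ} {y : X}
    (hy : y ∈ W) (hr : (σ ^ (r : ℤ)) y ∈ W) (k : ℤ) (b : Fin r) :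
    opEntry (S * T) (y, k) (y, b + 1) =
      ∑ m : Fin r, opEntry S (y, k) (y, m + 1) * opEntry T (y, m + 1) (y, b + 1) := by
  classical
  -- The visits at times `0` and `r` confine this column of `T` to the times `1, …, r`.
  have hsum : T (lp.single 2 (y, (b + 1 : ℤ)) 1) = ∑ m : Fin r,
      opEntry T (y, m + 1) (y, b + 1) • lp.single 2 (y, (m + 1 : ℤ)) (1 : ℂ) := by
    ext ⟨x, j⟩
    rw [lp.coeFn_sum, Finset.sum_apply]
    have hterm : ∀ m : Fin r, (opEntry T (y, m + 1) (y, b + 1) •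
        lp.single 2 (y, (m + 1 : ℤ)) (1 : ℂ) : RegRepSpace X) (x, j) =
          if x = y ∧ j = m + 1 then opEntry T (y, m + 1) (y, b + 1) else 0 := by
      intro m
      simp [Pi.single_apply]
    simp only [hterm]
    have hlhs : T (lp.single 2 (y, (b + 1 : ℤ)) 1) (x, j) =
        opEntry T (x, j) (y, b + 1) := by
      rw [opEntry]
    rw [hlhs]
    rcases eq_or_ne x y with rfl | hx
    · by_cases hj : 1 ≤ j ∧ j ≤ r
      · rw [Finset.sum_eq_single (⟨(j - 1).toNat, by omega⟩ : Fin r)]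
        · have hj' : j = ((j - 1).toNat : ℤ) + 1 := by omega
          rw [if_pos ⟨rfl, hj'⟩]
          exact congrArg (fun i => opEntry T (x, i) (x, b + 1)) hj'
        · intro m _ hm
          refine if_neg fun h => hm (Fin.ext ?_)
          have := h.2
          change (m : ℕ) = (j - 1).toNat
          omega
        · simp
      · rw [Finset.sum_eq_zero fun m _ => if_neg fun h => hj (by omega)]
        rcases lt_or_ge j 1 with h | h
        · exact hT.vanish x j (b + 1) 0 (by omega) hy
        · exact hT.vanish x j (b + 1) r (by omega) hr
    · rw [hT.off _ _ hx, Finset.sum_eq_zero fun m _ => if_neg fun h => hx h.1]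
  have hl : opEntry (S * T) (y, k) (y, b + 1) =
      S (T (lp.single 2 (y, (b + 1 : ℤ)) 1)) (y, k) := by
    rw [opEntry, mul_apply_eq_comp]
  rw [hl, hsum, map_sum, lp.coeFn_sum, Finset.sum_apply]
  refine Finset.sum_congr rfl fun m _ => ?_
  rw [map_smul, lp.coeFn_smul, Pi.smul_apply, smul_eq_mul, mul_comm]
  congr 1

variable [CompactSpace X]

theorem isOrbitLocal_of_mem {a : crossedProduct σ} (ha : a ∈ orbitBreaking σ W) :
    IsOrbitLocal σ W (a : RegRepSpace X →L[ℂ] RegRepSpace X) := by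
  have hcl : IsClosed {a : crossedProduct σ |
      IsOrbitLocal σ W (a : RegRepSpace X →L[ℂ] RegRepSpace X)} :=
    isClosed_isOrbitLocal.preimage continuous_subtype_val
  refine closure_minimal (fun b hb => ?_) hcl ha
  -- The induction is on left multiplication by `b` and by `star b`. This form passes through
  -- products and adjoints and needs only the case of weighted shifts for the generators.
  suffices h : ∀ T, IsOrbitLocal σ W T → IsOrbitLocal σ W (b.1 * T) ∧
      IsOrbitLocal σ W (star b.1 * T) by
    have := (h 1 isOrbitLocal_one).1
    rwa [mul_one] at this
  induction hb using StarAlgebra.adjoin_induction with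
  | mem x hx =>
    intro T hT
    rcases hx with ⟨f, rfl⟩ | ⟨g, hg, rfl⟩
    · constructor
      · refine hT.shift_mul (φ := f) (d := 0) f.continuous (fun x v h => by omega)
          (fun ξ p => ?_)
        rw [add_zero]
        exact regularMul_apply σ f ξ p
      · have hs : star (crossedFun σ f : RegRepSpace X →L[ℂ] RegRepSpace X) =
            regularMul σ (star f) := (map_star (regularRep σ) f).symm
        rw [hs]
        refine hT.shift_mul (φ := star f) (d := 0) (star f).continuous (fun x v h => by omega)
          (fun ξ p => ?_)
        rw [add_zero]
        exact regularMul_apply σ (star f) ξ p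
    · constructor
      -- `u g` is the shift with step `-1` and weight `g ∘ σ⁻¹`; its adjoint, treated next, has step
      -- `1` and weight `star g`.
      · refine hT.shift_mul (φ := fun x => g ((σ ^ (-1 : ℤ)) x)) (d := -1)
          (g.continuous.comp (σ ^ (-1 : ℤ)).continuous) (fun x v h hv => ?_) (fun ξ p => ?_)
        · obtain rfl : v = -1 := by omega
          exact hg _ hv
        · rw [zpow_eq_of_eq_add σ rfl, add_comm (-1)]
          exact regularMul_apply σ g ξ (p.1, p.2 - 1)
      · have hs : star ((crossedUnit σ * crossedFun σ g : crossedProduct σ) :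
            RegRepSpace X →L[ℂ] RegRepSpace X) =
              regularMul σ (star g) * star (regularShift X) := by
          refine (star_mul (regularShift X) (regularMul σ g)).trans ?_
          congr 1
          exact (map_star (regularRep σ) g).symm
        rw [hs]
        refine hT.shift_mul (φ := star g) (d := 1) (star g).continuous
          (fun x v h hv => ?_) (fun ξ p => ?_)
        · obtain rfl : v = 0 := by omega
          exact (congrArg star (hg x hv)).trans (star_zero ℂ)
        · exact (regularMul_apply σ (star g) _ p).trans
            (congrArg _ (star_regularShift_apply ξ p))
  | algebraMap c =>
    intro T hT
    have hc : ((algebraMap ℂ (crossedProduct σ) c : crossedProduct σ) :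
        RegRepSpace X →L[ℂ] RegRepSpace X) = c • 1 := Algebra.algebraMap_eq_smul_one c
    rw [hc, star_smul, star_one, smul_mul_assoc, smul_mul_assoc, one_mul]
    exact ⟨hT.smul c, hT.smul (star c)⟩
  | add x y _ _ hx hy =>
    intro T hT
    rw [show ((x + y : crossedProduct σ) : RegRepSpace X →L[ℂ] RegRepSpace X) = x.1 + y.1 from rfl,
      star_add, add_mul, add_mul]
    exact ⟨(hx T hT).1.add (hy T hT).1, (hx T hT).2.add (hy T hT).2⟩
  | mul x y _ _ hx hy =>
    intro T hT
    rw [show ((x * y : crossedProduct σ) : RegRepSpace X →L[ℂ] RegRepSpace X) = x.1 * y.1 from rfl,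
      star_mul, mul_assoc, mul_assoc]
    exact ⟨(hx _ (hy T hT).1).1, (hy _ (hx T hT).2).2⟩
  | star x _ hx =>
    intro T hT
    rw [show ((star x : crossedProduct σ) : RegRepSpace X →L[ℂ] RegRepSpace X) = star x.1 from rfl,
      star_star]
    exact (hx T hT).symm

end Entries

/-! ### The block representation of the orbit-breaking algebra -/

section Presentation

variable {X : Type u} [TopologicalSpace X] [CompactSpace X] {σ : X ≃ₜ X} {W : Set X} {N : ℕ}
  {l : ℕ} {n : Fin (l + 1) → ℕ}

/-- The underlying operator of an element of `A_W`. -/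
def orbitOp (a : orbitBreaking σ W) : RegRepSpace X →L[ℂ] RegRepSpace X := a.1.1

theorem orbitOp_local (a : orbitBreaking σ W) : IsOrbitLocal σ W (orbitOp a) :=
  isOrbitLocal_of_mem a.2

/-- The compression of the elements of `A_W` to the orbit segments from a point to its return. -/
noncomputable def orbitHom (h : ReturnsWithin σ W N) (hW : IsClosed W) (n : Fin (l + 1) → ℕ) :
    orbitBreaking σ W →⋆ₐ[ℂ] MatFun (fun i => ReturnSpace σ W (n i)) n where
  toFun a i := ⟨fun y => Matrix.of fun c d : Fin (n i) =>
    opEntry (orbitOp a) (y.1, c + 1) (y.1, d + 1), continuous_matrix fun c d =>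
      ((orbitOp_local a).continuous (c + 1) (d + 1)).comp continuous_subtype_val⟩
  map_one' := by
    classical
    ext i y c d
    refine (opEntry_one _ _).trans ?_
    simp [Matrix.one_apply, Fin.ext_iff]
  map_mul' a b := by
    ext i y c d
    have hy := h.mem_of_mem_closure hW y.2
    exact (orbitOp_local b).opEntry_mul (orbitOp a) hy.1 hy.2 (c + 1) d
  map_zero' := by
    ext i y c d
    rfl
  map_add' a b := by
    ext i y c d
    rfl
  commutes' r := by
    classical
    ext i y c d
    refine (congrArg (r * ·) (opEntry_one _ _)).trans ?_
    change _ = (algebraMap ℂ (Mat (n i)) r) c d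
    simp [Matrix.algebraMap_matrix_apply, Fin.ext_iff]
  map_star' a := by
    ext i y c d
    exact opEntry_star (orbitOp a) _ _

theorem orbitHom_apply (h : ReturnsWithin σ W N) (hW : IsClosed W) (n : Fin (l + 1) → ℕ)
    (a : orbitBreaking σ W) (i : Fin (l + 1)) (y : ReturnSpace σ W (n i)) (c d : Fin (n i)) :
    orbitHom h hW n a i y c d = opEntry (orbitOp a) (y.1, c + 1) (y.1, d + 1) := rfl

/-- By equivariance an entry can be read from the start of the block containing its column. If the
row lies in that block, the entry occurs in `orbitHom`; otherwise it vanishes. -/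
theorem orbitHom_injective (h : ReturnsWithin σ W N) (hW : IsClosed W)
    (hr : ∀ y ∈ W, ∃ i, n i = returnTime σ W y) : Function.Injective (orbitHom h hW n) := by
  intro a b hab
  refine Subtype.ext (Subtype.ext (opEntry_injective ?_))
  rintro ⟨x, k⟩ ⟨x', m⟩
  change opEntry (orbitOp a) _ _ = opEntry (orbitOp b) _ _
  have ha := orbitOp_local a
  have hb := orbitOp_local b
  rcases eq_or_ne x x' with rfl | hx
  · obtain ⟨⟨i, c⟩, hc⟩ := exists_position h hr ((σ ^ m) x)
    have hl := h.mem_returnLevel.1 hc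
    have hc' := hc
    simp only [IsBlockPosition] at hl hc'
    rw [zpow_eq_of_eq_add σ rfl] at hl hc'
    rw [zpow_eq_of_eq_add σ rfl] at hl
    by_cases hk : 0 ≤ k - m + c ∧ k - m + c < n i
    · have := congrArg (fun f => f i ⟨_, subset_closure hc'⟩ ⟨(k - m + c).toNat, by omega⟩ c) hab
      simp only [orbitHom_apply, ha.equivariant, hb.equivariant] at this
      have e1 : ((k - m + c).toNat : ℤ) + 1 + (-(c : ℤ) - 1 + m) = k := by omega
      have e2 : (c : ℤ) + 1 + (-(c : ℤ) - 1 + m) = m := by omega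
      rwa [e1, e2] at this
    · rcases lt_or_ge (k - m + c) 0 with hlt | hge
      · rw [ha.vanish x k m (-(c : ℤ) - 1 + m) (by omega) hl.1,
          hb.vanish x k m (-(c : ℤ) - 1 + m) (by omega) hl.1]
      · rw [ha.vanish x k m _ (by omega) hl.2.2.1, hb.vanish x k m _ (by omega) hl.2.2.1]
  · rw [ha.off _ _ hx, hb.off _ _ hx]

/-- Along a cut of an orbit segment, the compression of an element of `A_W` is block diagonal. -/
theorem isBlockDiag_orbitHom (h : ReturnsWithin σ W N) (hW : IsClosed W) (a : orbitBreaking σ W)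
    {q : ℕ} {z : X} {s : ℕ} {t : Fin s → Fin (l + 1)} {p : ∀ k, ReturnSpace σ W (n (t k))}
    (hc : IsCut σ W n q z t p) :
    IsBlockDiag (fun k => n (t k)) (fun k => orbitHom h hW n a (t k) (p k))
      (Matrix.of fun c d : Fin q => opEntry (orbitOp a) (z, c + 1) (z, d + 1)) := by
  have ha := orbitOp_local a
  have hvisit : ∀ k, (σ ^ ((∑ j ∈ Finset.Iio k, n (t j) : ℕ) : ℤ)) z ∈ W := fun k => by
    rw [hc.zpow_point k (a := 0) (by omega)]
    exact (hc.mem_level k).1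
  refine isBlockDiag_of_entries hc.sum_eq ?_ ?_
  · intro k c d i j hi hj
    rw [Matrix.of_apply, orbitHom_apply]
    have hp := hc.zpow_point k (i := (∑ j ∈ Finset.Iio k, n (t j) : ℕ)) (a := 0) (by omega)
    rw [show (p k : X) = _ from hp.symm, ha.equivariant]
    congr 2 <;> omega
  · intro k k' c d i j hk hi hj
    rcases lt_or_gt_of_ne hk with hlt | hlt
    · have := sum_Iio_add_le (d := fun j => n (t j)) hlt
      exact ha.vanish z _ _ _ (by omega) (hvisit k')
    · have := sum_Iio_add_le (d := fun j => n (t j)) hlt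
      exact ha.vanish z _ _ _ (by omega) (hvisit k)

theorem orbitHom_mem_compatAlg (h : ReturnsWithin σ W N) (hW : IsClosed W)
    (hn : Function.Injective n) (hr : ∀ y ∈ W, ∃ i, n i = returnTime σ W y)
    (a : orbitBreaking σ W) :
    orbitHom h hW n a ∈ compatAlg h hW hn (isReturnFamily_of_exists hr) :=
  fun _ => isKernelAt_of_isBlockDiag h hW hn (isReturnFamily_of_exists hr) fun _ _ _ _ hc =>
    isBlockDiag_orbitHom h hW a hc

end Presentation

/-! ## Elements of the orbit-breaking algebra -/

theorem regularShift_pow_apply {X : Type u} (m : ℕ) (ξ : RegRepSpace X) (p : X × ℤ) :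
    ((regularShift X) ^ m) ξ p = ξ (p.1, p.2 - m) := by
  induction m generalizing p with
  | zero => simp
  | succ m ih =>
    rw [pow_succ', mul_apply_eq_comp, regularShift_apply, ih,
      show p.2 - 1 - (m : ℤ) = p.2 - (m + 1 : ℕ) by push_cast; ring]

/-- Take `√|g|` and `g / √|g|`, the latter continuous at zeros since its modulus is `√|g|`. Both
factors inherit the zeros of `g`, so different generators can each use them. -/
theorem exists_factor_vanishing {X : Type u} [TopologicalSpace X] (g : C(X, ℂ)) : ∃ g₁ g₂ : C(X, ℂ), g = g₁ * g₂ ∧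
    ∀ x, g x = 0 → g₁ x = 0 ∧ g₂ x = 0 := by
  have hcont : Continuous fun z : ℂ => z / (Real.sqrt ‖z‖ : ℂ) := by
    rw [continuous_iff_continuousAt]
    intro z
    rcases eq_or_ne z 0 with rfl | hz
    · rw [ContinuousAt, zero_div, tendsto_zero_iff_norm_tendsto_zero]
      have heq : (fun z : ℂ => ‖z / (Real.sqrt ‖z‖ : ℂ)‖) = fun z => Real.sqrt ‖z‖ := by
        funext z
        rw [norm_div, Complex.norm_real, Real.norm_of_nonneg (Real.sqrt_nonneg _), Real.div_sqrt]
      rw [heq]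
      have : Continuous fun z : ℂ => Real.sqrt ‖z‖ := by fun_prop
      simpa using this.tendsto 0
    · refine ContinuousAt.div continuousAt_id (by fun_prop) ?_
      simpa using hz
  refine ⟨⟨fun x => (Real.sqrt ‖g x‖ : ℂ), by fun_prop⟩, ⟨_, hcont.comp g.continuous⟩, ?_, ?_⟩
  · ext x
    change g x = (Real.sqrt ‖g x‖ : ℂ) * (g x / (Real.sqrt ‖g x‖ : ℂ))
    rcases eq_or_ne (g x) 0 with h0 | h0
    · simp [h0]
    · rw [mul_div_cancel₀]
      simpa using h0
  · intro x hx
    simp [hx]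

section Elements

variable {X : Type u} [TopologicalSpace X] [CompactSpace X] {σ : X ≃ₜ X} {W : Set X} {N : ℕ}

theorem crossedUnit_mul_crossedFun (σ : X ≃ₜ X) (f : C(X, ℂ)) :
    crossedUnit σ * crossedFun σ f =
      crossedFun σ (f.comp (σ.symm : C(X, X))) * crossedUnit σ := by
  rw [← crossedUnit_covariance, mul_assoc,
    (Unitary.mem_iff.1 (crossedUnit_mem_unitary σ)).1, mul_one]

/-- One generator is split off at a time: `u^(m+1) g₁ g₂ = (u^m (g₁ ∘ σ⁻¹)) (u g₂)`. The factor `g₂`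
uses the vanishing at `v = 0`, and `g₁ ∘ σ⁻¹` the remaining times shifted by one. -/
theorem crossedUnit_pow_mul_mem (m : ℕ) (g : C(X, ℂ))
    (hg : ∀ x, ∀ v : ℤ, 0 ≤ v → v < m → (σ ^ v) x ∈ W → g x = 0) :
    crossedUnit σ ^ m * crossedFun σ g ∈ orbitBreaking σ W := by
  induction m generalizing g with
  | zero =>
    rw [pow_zero, one_mul]
    exact crossedFun_mem σ W g
  | succ m ih =>
    obtain ⟨g₁, g₂, rfl, h0⟩ := exists_factor_vanishing g
    have heq : crossedUnit σ ^ (m + 1) * crossedFun σ (g₁ * g₂) =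
        (crossedUnit σ ^ m * crossedFun σ (g₁.comp (σ.symm : C(X, X)))) *
          (crossedUnit σ * crossedFun σ g₂) := by
      rw [pow_succ, map_mul, mul_assoc, ← mul_assoc (crossedUnit σ), crossedUnit_mul_crossedFun]
      simp only [mul_assoc]
    rw [heq]
    refine mul_mem (ih _ fun x v hv hvm hx => ?_) (crossedUnit_mul_mem σ W g₂ fun y hy => ?_)
    · refine (h0 _ (hg (σ.symm x) (v + 1) (by omega) (by push_cast; omega) ?_)).1
      rw [zpow_add_apply, zpow_one, Homeomorph.apply_symm_apply]
      exact hx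
    · exact (h0 _ (hg y 0 le_rfl (by push_cast; omega) hy)).2

theorem opEntry_crossedUnit_pow_mul (m : ℕ) (g : C(X, ℂ)) (x : X) (k l : ℤ) :
    opEntry (crossedUnit σ ^ m * crossedFun σ g : crossedProduct σ).1 (x, k) (x, l) =
      if k - l = m then g ((σ ^ l) x) else 0 := by
  classical
  have h1 : (crossedUnit σ ^ m * crossedFun σ g : crossedProduct σ).1 =
      regularShift X ^ m * regularMul σ g := rfl
  rw [h1, opEntry, mul_apply_eq_comp, regularShift_pow_apply, regularMul_apply]
  simp only [lp.single_apply, Pi.single_apply, Prod.mk.injEq, true_and]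
  by_cases h : k - l = m
  · rw [if_pos (by omega), if_pos h, mul_one, show k - m = l by omega]
  · rw [if_neg (by omega), if_neg h, mul_zero]

end Elements

/-! ### Every compatible family comes from the algebra -/

section Surjectivity

variable {X : Type u} [TopologicalSpace X] [CompactSpace X] {σ : X ≃ₜ X} {W : Set X} {N : ℕ}
  {l : ℕ} {n : Fin (l + 1) → ℕ}

/-- The operator is rebuilt diagonal by diagonal from the kernel, which is continuous on all of `X`
and has the zeros needed for each term to lie in `A_W`. -/
theorem exists_orbitHom_eq (h : ReturnsWithin σ W N) (hW : IsClosed W)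
    (hn : Function.Injective n) (hr : ∀ y ∈ W, ∃ i, n i = returnTime σ W y)
    (hle : ∀ i, n i ≤ N) {f : MatFun (fun i => ReturnSpace σ W (n i)) n}
    (hf : ∀ i, IsKernelAt f i) : ∃ a, orbitHom h hW n a = f := by
  have hcont : ∀ m j : ℤ, Continuous fun x => blockKernel f m ((σ ^ j) x) := fun m j =>
    h.continuous_blockKernel hW hn f (σ ^ j).continuous (fun x => by
      obtain ⟨c, hc⟩ := exists_position h hr ((σ ^ j) x)
      exact ⟨c, hf c.1, hc⟩) m
  let g (m : ℕ) : C(X, ℂ) := ⟨fun x => blockKernel f m ((σ ^ (0 : ℤ)) x), hcont m 0⟩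
  -- Superdiagonals are adjoints of terms `u^m g'`. Taking adjoints exchanges row and column, while
  -- the kernel is indexed by the column; hence the conjugation and the factor `σ ^ m`.
  let g' (m : ℕ) : C(X, ℂ) := star ⟨fun x => blockKernel f (-m) ((σ ^ (m : ℤ)) x), hcont (-m) m⟩
  have hg : ∀ m, crossedUnit σ ^ m * crossedFun σ (g m) ∈ orbitBreaking σ W := fun m =>
    crossedUnit_pow_mul_mem m _ fun x v h0 hv hx =>
      h.blockKernel_eq_zero hn f (Or.inl ⟨h0, hv⟩) hx
  have hg' : ∀ m, crossedUnit σ ^ m * crossedFun σ (g' m) ∈ orbitBreaking σ W := fun m =>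
    crossedUnit_pow_mul_mem m _ fun x v h0 hv hx => by
      refine (congrArg star (h.blockKernel_eq_zero hn f (v := v - m) (by omega) ?_)).trans
        (star_zero ℂ)
      rwa [zpow_eq_of_eq_add σ (a := v) (by omega)]
  -- Since every `n i ≤ N`, offsets below `N` suffice. The adjoint terms start at offset `1`, so the
  -- diagonal is counted once.
  let a : orbitBreaking σ W := ∑ m ∈ Finset.range N, ⟨_, hg m⟩ +
    ∑ m ∈ Finset.range N, star ⟨_, hg' (m + 1)⟩
  have hop : orbitOp a = ∑ m ∈ Finset.range N, (crossedUnit σ ^ m * crossedFun σ (g m)).1 +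
      ∑ m ∈ Finset.range N, star (crossedUnit σ ^ (m + 1) * crossedFun σ (g' (m + 1))).1 := by
    simp [orbitOp, a]
  refine ⟨a, ?_⟩
  ext i y c d
  have hi := hle i
  rw [orbitHom_apply, hf i y c d, hop, opEntry_add, opEntry_sum, opEntry_sum]
  simp only [opEntry_star, opEntry_crossedUnit_pow_mul]
  rcases le_or_gt d c with hdc | hdc
  · rw [Fin.le_def] at hdc
    rw [Finset.sum_eq_single_of_mem ((c : ℕ) - d) (Finset.mem_range.2 (by omega))
      (fun m _ hm => if_neg (by omega)), if_pos (by omega),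
      Finset.sum_eq_zero (fun m _ => by rw [if_neg (by omega), star_zero]), add_zero]
    change blockKernel f _ _ = _
    congr 1
    omega
  · rw [Fin.lt_def] at hdc
    rw [Finset.sum_eq_zero (fun m _ => if_neg (by omega)), zero_add,
      Finset.sum_eq_single_of_mem ((d : ℕ) - c - 1) (Finset.mem_range.2 (by omega))
      (fun m _ hm => by rw [if_neg (by omega), star_zero]), if_pos (by omega)]
    refine (star_star _).trans ?_
    rw [ContinuousMap.coe_mk, zpow_eq_of_eq_add σ rfl]
    congr 1
    · omega
    · congr 2
      omega

end Surjectivity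

/-! ### The presentation and the inclusion of algebras -/

section Main

theorem exists_returnTimes {X : Type u} [TopologicalSpace X] {σ : X ≃ₜ X} {W : Set X} {N : ℕ}
    (h : ReturnsWithin σ W N) (hne : W.Nonempty) :
    ∃ (l : ℕ) (n : Fin (l + 1) → ℕ), StrictMono n ∧ Set.range n = returnTime σ W '' W := by
  have hfin : (returnTime σ W '' W).Finite :=
    (Set.finite_Iic N).subset (by rintro _ ⟨y, _, rfl⟩; exact h.returnTime_le y)
  have hcard : 0 < hfin.toFinset.card :=
    Finset.card_pos.2 (hfin.toFinset_nonempty.2 (hne.image _))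
  obtain ⟨l, hl⟩ : ∃ l, hfin.toFinset.card = l + 1 := ⟨_, (Nat.succ_pred_eq_of_pos hcard).symm⟩
  exact ⟨l, hfin.toFinset.orderEmbOfFin hl, (hfin.toFinset.orderEmbOfFin hl).strictMono,
    (Finset.range_orderEmbOfFin _ hl).trans hfin.coe_toFinset⟩

variable {X : Type u} [TopologicalSpace X] [CompactSpace X] {σ : X ≃ₜ X} {W : Set X} {N : ℕ}

/-- The isomorphism of `A_W` with its image in the matrix-valued functions on the return spaces. -/
noncomputable def orbitEquiv (h : ReturnsWithin σ W N) (hW : IsClosed W) {l : ℕ}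
    {n : Fin (l + 1) → ℕ} (hn : Function.Injective n)
    (hr : ∀ y ∈ W, ∃ i, n i = returnTime σ W y) (hle : ∀ i, n i ≤ N) :
    orbitBreaking σ W ≃⋆ₐ[ℂ] compatAlg h hW hn (isReturnFamily_of_exists hr) :=
  StarAlgEquiv.ofBijective
    ((orbitHom h hW n).codRestrict _ (orbitHom_mem_compatAlg h hW hn hr))
    ⟨fun _ _ hab => orbitHom_injective h hW hr (congrArg Subtype.val hab), fun f => by
      obtain ⟨a, ha⟩ := exists_orbitHom_eq h hW hn hr hle f.2
      exact ⟨a, Subtype.ext ha⟩⟩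

theorem coe_orbitEquiv (h : ReturnsWithin σ W N) (hW : IsClosed W) {l : ℕ}
    {n : Fin (l + 1) → ℕ} (hn : Function.Injective n)
    (hr : ∀ y ∈ W, ∃ i, n i = returnTime σ W y) (hle : ∀ i, n i ≤ N) (a : orbitBreaking σ W) :
    (orbitEquiv h hW hn hr hle a).1 = orbitHom h hW n a := rfl

theorem isReturnPresentation_orbitEquiv [T2Space X] (h : ReturnsWithin σ W N) (hW : IsClosed W)
    {l : ℕ} {n : Fin (l + 1) → ℕ} (hn : StrictMono n)
    (hrange : Set.range n = returnTime σ W '' W)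
    (hr : ∀ y ∈ W, ∃ i, n i = returnTime σ W y) (hle : ∀ i, n i ≤ N) :
    IsReturnPresentation σ W n (compatAlg h hW hn.injective (isReturnFamily_of_exists hr))
      (orbitEquiv h hW hn.injective hr hle) where
  returns y _ := by
    obtain ⟨k, h1, _, h3⟩ := h y
    exact ⟨k, h1, by simpa using h3⟩
  strictMono := hn
  range_eq := hrange
  isDSH := isDSH_compatAlg h hW hn hr fun i => by
    obtain ⟨y, _, hy⟩ : n i ∈ returnTime σ W '' W := hrange ▸ Set.mem_range_self i
    exact hy ▸ h.returnTime_pos y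
  apply_fun f i y := by
    have hf : orbitOp (⟨crossedFun σ f, crossedFun_mem σ W f⟩ : orbitBreaking σ W) =
        (crossedUnit σ ^ 0 * crossedFun σ f : crossedProduct σ).1 := by
      rw [pow_zero, one_mul]; rfl
    ext c d
    rw [coe_orbitEquiv, orbitHom_apply, hf, opEntry_crossedUnit_pow_mul, Matrix.diagonal_apply]
    by_cases hcd : c = d
    · subst hcd
      rw [if_pos (by simp), if_pos rfl]
      exact congrArg (fun τ : X ≃ₜ X => f (τ y.1)) (zpow_natCast σ (c.1 + 1))
    · rw [if_neg hcd, if_neg fun h => hcd (Fin.ext (by omega))]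
  apply_unit_mul g hg i y := by
    have hf : orbitOp (⟨crossedUnit σ * crossedFun σ g, crossedUnit_mul_mem σ W g hg⟩ :
        orbitBreaking σ W) = (crossedUnit σ ^ 1 * crossedFun σ g : crossedProduct σ).1 := by
      rw [pow_one]; rfl
    ext c d
    rw [coe_orbitEquiv, orbitHom_apply, hf, opEntry_crossedUnit_pow_mul, Matrix.of_apply]
    by_cases hcd : c.1 = d.1 + 1
    · rw [if_pos (by omega), if_pos hcd]
      exact congrArg (fun τ : X ≃ₜ X => g (τ y.1)) (zpow_natCast σ (d.1 + 1))
    · rw [if_neg (by omega), if_neg hcd]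
  boundary i y hy := by
    have hyW := h.mem_of_mem_closure hW y.2
    obtain ⟨s, t, p, hc⟩ := h.exists_isCut
      ((isReturnFamily_of_exists hr).coversReturns i y.1) hyW.1 hyW.2
    refine ⟨s, t, p, h.isReturnSplitting_of_isCut hc, fun k => ?_,
      fun f => (f.2 i).isBlockDiag h hn.injective hc⟩
    -- A piece not shorter than `n i` would put `y` in the return level, contrary to `hy`.
    by_contra! hle
    exact hy (hc.eq_of_le k (hn.monotone hle)).2

theorem exists_presentation [T2Space X] (hσ : IsMinimalHomeo σ)
    (hW : ∃ U, IsOpen U ∧ W = closure U) (hne : W.Nonempty) :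
    ∃ (N : ℕ) (_ : ReturnsWithin σ W N) (l : ℕ) (n : Fin (l + 1) → ℕ), StrictMono n ∧
      Set.range n = returnTime σ W '' W ∧ (∀ y ∈ W, ∃ i, n i = returnTime σ W y) ∧
      (∀ i, n i ≤ N) ∧ IsClosed W := by
  obtain ⟨U, hU, rfl⟩ := hW
  obtain ⟨N, h⟩ := exists_returnsWithin hσ hU (closure_nonempty_iff.1 hne) subset_closure
  obtain ⟨l, n, hn, hrange⟩ := exists_returnTimes h hne
  refine ⟨N, h, l, n, hn, hrange, fun y hy => ?_, fun i => ?_, isClosed_closure⟩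
  · exact Set.mem_range.1 (hrange ▸ Set.mem_image_of_mem _ hy)
  · obtain ⟨y, _, hy⟩ : n i ∈ returnTime σ (closure U) '' closure U :=
      hrange ▸ Set.mem_range_self i
    exact hy ▸ h.returnTime_le y

theorem inclusionHom_apply {Y Z : Set X} (hZY : Z ⊆ Y) {B : Type v} {C : Type w} [Semiring B]
    [Algebra ℂ B] [StarRing B] [Semiring C] [Algebra ℂ C] [StarRing C]
    (ΨY : orbitBreaking σ Y ≃⋆ₐ[ℂ] B) (ΨZ : orbitBreaking σ Z ≃⋆ₐ[ℂ] C)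
    (a : orbitBreaking σ Y) : inclusionHom σ hZY ΨY ΨZ (ΨY a) =
      ΨZ (StarSubalgebra.inclusion (orbitBreaking_anti σ hZY) a) :=
  congrArg (fun b => ΨZ (StarSubalgebra.inclusion (orbitBreaking_anti σ hZY) b))
    (ΨY.symm_apply_apply a)

theorem orbitHom_eq_of_opEntry (h : ReturnsWithin σ W N) (hW : IsClosed W) {l : ℕ}
    (n : Fin (l + 1) → ℕ) (a : orbitBreaking σ W) (i : Fin (l + 1)) (y : ReturnSpace σ W (n i)) :
    orbitHom h hW n a i y = Matrix.of fun c d : Fin (n i) =>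
      opEntry (orbitOp a) (y.1, c + 1) (y.1, d + 1) := rfl

theorem StarSubalgebra.coe_inclusion_apply {A : Type*} [Semiring A] [Algebra ℂ A] [StarRing A]
    [StarModule ℂ A] {S T : StarSubalgebra ℂ A} (h : S ≤ T) (a : S) :
    (StarSubalgebra.inclusion h a : A) = a := rfl

theorem orbitOp_inclusion {Y Z : Set X} (hZY : Z ⊆ Y) (a : orbitBreaking σ Y) :
    orbitOp (StarSubalgebra.inclusion (orbitBreaking_anti σ hZY) a) = orbitOp a :=
  congrArg Subtype.val (StarSubalgebra.coe_inclusion_apply (orbitBreaking_anti σ hZY) a)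

/-- The inclusion `A_Y ⊆ A_Z` is block diagonal along the visits to `Y`. -/
theorem isBlockDiag_inclusionHom {Y Z : Set X} (hZY : Z ⊆ Y) (hN : ReturnsWithin σ Y N)
    (hYc : IsClosed Y) {l : ℕ} {n : Fin (l + 1) → ℕ} {M : ℕ} (hM : ReturnsWithin σ Z M)
    (hZc : IsClosed Z) {m : ℕ} {q : Fin (m + 1) → ℕ}
    {DY : StarSubalgebra ℂ (MatFun (fun i => ReturnSpace σ Y (n i)) n)}
    {DZ : StarSubalgebra ℂ (MatFun (fun i => ReturnSpace σ Z (q i)) q)}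
    (ΨY : orbitBreaking σ Y ≃⋆ₐ[ℂ] DY) (ΨZ : orbitBreaking σ Z ≃⋆ₐ[ℂ] DZ)
    (hΨY : ∀ a, (ΨY a).1 = orbitHom hN hYc n a) (hΨZ : ∀ a, (ΨZ a).1 = orbitHom hM hZc q a)
    {i : Fin (m + 1)} {z : ReturnSpace σ Z (q i)} {s : ℕ}
    {t : Fin s → Fin (l + 1)} {p : ∀ k, ReturnSpace σ Y (n (t k))}
    (hc : IsCut σ Y n (q i) z.1 t p) (f : DY) :
    IsBlockDiag (fun k => n (t k)) (fun k => f.1 (t k) (p k))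
      ((inclusionHom σ hZY ΨY ΨZ f).1 i z) := by
  obtain ⟨a, rfl⟩ : ∃ a, ΨY a = f := ⟨_, ΨY.apply_symm_apply f⟩
  rw [inclusionHom_apply, hΨY, hΨZ, orbitHom_eq_of_opEntry, orbitOp_inclusion hZY]
  exact isBlockDiag_orbitHom hN hYc a hc

end Main

theorem lemma1p4 {X : Type u} [TopologicalSpace X] [CompactSpace X] [T2Space X] [Infinite X]
    (σ : X ≃ₜ X) (hσ : IsMinimalHomeo σ) (Y Z : Set X)
    (hY : ∃ U, IsOpen U ∧ Y = closure U) (hZ : ∃ U, IsOpen U ∧ Z = closure U)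
    (hne : Z.Nonempty) (hZY : Z ⊆ Y) :
    ∃ (l m : ℕ) (n : Fin (l + 1) → ℕ) (q : Fin (m + 1) → ℕ)
      (DY : StarSubalgebra ℂ (MatFun (fun i => ReturnSpace σ Y (n i)) n))
      (DZ : StarSubalgebra ℂ (MatFun (fun i => ReturnSpace σ Z (q i)) q))
      (ΨY : orbitBreaking σ Y ≃⋆ₐ[ℂ] DY) (ΨZ : orbitBreaking σ Z ≃⋆ₐ[ℂ] DZ),
      IsReturnPresentation σ Y n DY ΨY ∧ IsReturnPresentation σ Z q DZ ΨZ ∧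
      IsDiagonalMap (inclusionHom σ hZY ΨY ΨZ) ∧
      ∀ (i : Fin (m + 1)) (z : ReturnSpace σ Z (q i)),
        ∃ (s : ℕ) (t : Fin s → Fin (l + 1)) (p : ∀ k, ReturnSpace σ Y (n (t k))),
          IsReturnSplitting σ Y n (q i) z.1 t p ∧
            ∀ f : DY, IsBlockDiag (fun k => n (t k)) (fun k => f.1 (t k) (p k))
              ((inclusionHom σ hZY ΨY ΨZ f).1 i z) := by
  obtain ⟨N, hN, l, n, hn, hnrange, hnr, hnle, hYc⟩ :=
    exists_presentation hσ hY (hne.mono hZY)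
  obtain ⟨M, hM, m, q, hq, hqrange, hqr, hqle, hZc⟩ := exists_presentation hσ hZ hne
  have key : ∀ (i : Fin (m + 1)) (z : ReturnSpace σ Z (q i)),
      ∃ (s : ℕ) (t : Fin s → Fin (l + 1)) (p : ∀ k, ReturnSpace σ Y (n (t k))),
        IsReturnSplitting σ Y n (q i) z.1 t p ∧
          ∀ f : compatAlg hN hYc hn.injective (isReturnFamily_of_exists hnr),
            IsBlockDiag (fun k => n (t k)) (fun k => f.1 (t k) (p k))
              ((inclusionHom σ hZY (orbitEquiv hN hYc hn.injective hnr hnle)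
                (orbitEquiv hM hZc hq.injective hqr hqle) f).1 i z) := by
    intro i z
    have hz := hM.mem_of_mem_closure hZc z.2
    -- The segment from `Z` to `Z` has both ends in `Y`, and `n` lists every return time to `Y`, so
    -- it can be cut at the visits to `Y`.
    obtain ⟨s, t, p, hc⟩ := hN.exists_isCut (n := n) (q := q i) (z := z.1)
      (fun j hj _ => hnr _ hj) (hZY hz.1) (hZY hz.2)
    refine ⟨s, t, p, hN.isReturnSplitting_of_isCut hc, fun f => ?_⟩
    exact isBlockDiag_inclusionHom hZY hN hYc hM hZc _ _ (fun _ => rfl) (fun _ => rfl) hc f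
  refine ⟨l, m, n, q, compatAlg hN hYc hn.injective (isReturnFamily_of_exists hnr),
    compatAlg hM hZc hq.injective (isReturnFamily_of_exists hqr), orbitEquiv hN hYc hn.injective hnr hnle,
    orbitEquiv hM hZc hq.injective hqr hqle,
    isReturnPresentation_orbitEquiv hN hYc hn hnrange hnr hnle,
    isReturnPresentation_orbitEquiv hM hZc hq hqrange hqr hqle, fun i z => ?_, key⟩
  obtain ⟨s, t, p, _, hf⟩ := key i z
  exact ⟨s, t, p, hf⟩
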